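/- Let $f:\mathbb C\to\mathbb C$ be a transcendental entire function in the Eremenko--Lyubich class $B$, i.e. the set of all critical values and finite asymptotic values of $f$ is bounded. Let $J(f)$ be the Julia set of $f$, that is, the complement of the set of points having a neighbourhood in which the iterates $(f^n)_{n\in\mathbb N}$ form a normal family, and let $\dim$ denote Hausdorff dimension. (i) Let $q\ge 1$ and suppose that for each $\varepsilon>0$ there exists $r_\varepsilon>0$ such that $$|f(z)|\le \exp\left(\exp\left((\log|z|)^{q+\varepsilon}\right)\right)\quad\text{for } |z|\ge r_\varepsilon .$$ Then $\dim J(f)\ge 1+\frac1q$. (ii) In particular, with $M(r,f)=\max_{|z|=r}|f(z)|$, if $$\limsup_{r\to\infty}\frac{\log\log\log M(r,f)}{\log\log r}=1,$$ then $\dim J(f)=2$. -/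

import Mathlib

open Filter Topology

namespace EntireDynamics

/-- `f` is a transcendental entire function: holomorphic on all of `ℂ` and not a polynomial. -/
def IsTranscendentalEntire (f : ℂ → ℂ) : Prop :=
  Differentiable ℂ f ∧ ¬ ∃ p : Polynomial ℂ, ∀ z, f z = p.eval z

/-- The critical values of `f`: the images of the zeros of `f'`. -/
def criticalValues (f : ℂ → ℂ) : Set ℂ :=
  f '' {z | deriv f z = 0}

/-- The finite asymptotic values of `f`: the limits of `f` along curves tending to `∞`. -/
def asymptoticValues (f : ℂ → ℂ) : Set ℂ :=
  {a | ∃ γ : ℝ → ℂ, ContinuousOn γ (Set.Ici 0) ∧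
    Tendsto (fun t => ‖γ t‖) atTop atTop ∧ Tendsto (fun t => f (γ t)) atTop (𝓝 a)}

/-- The Eremenko–Lyubich class `B`: transcendental entire functions whose set of critical values
and finite asymptotic values is bounded. -/
def ClassB (f : ℂ → ℂ) : Prop :=
  IsTranscendentalEntire f ∧ Bornology.IsBounded (criticalValues f ∪ asymptoticValues f)

/-- The sequence `F` of functions tends to `∞` uniformly on the compact subsets of `U`. -/
def TendstoInftyLocallyUniformlyOn (F : ℕ → ℂ → ℂ) (U : Set ℂ) : Prop :=
  ∀ K ⊆ U, IsCompact K → ∀ R : ℝ, ∀ᶠ n in atTop, ∀ z ∈ K, R ≤ ‖F n z‖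

/-- Normality of a family of holomorphic functions on a domain (connected open set) `U`:
every sequence in the family has a subsequence that converges locally uniformly on `U`,
either to a finite (then holomorphic) function or to `∞`. -/
def IsNormalFamilyOn {ι : Type*} (F : ι → ℂ → ℂ) (U : Set ℂ) : Prop :=
  ∀ s : ℕ → ι, ∃ φ : ℕ → ℕ, StrictMono φ ∧
    ((∃ g : ℂ → ℂ, TendstoLocallyUniformlyOn (fun k => F (s (φ k))) g atTop U) ∨
      TendstoInftyLocallyUniformlyOn (fun k => F (s (φ k))) U)

/-- The Fatou set: the points with a (connected open) neighbourhood on which the iterates of `f`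
form a normal family. -/
def fatouSet (f : ℂ → ℂ) : Set ℂ :=
  {z | ∃ U : Set ℂ, IsOpen U ∧ IsConnected U ∧ z ∈ U ∧ IsNormalFamilyOn (fun n : ℕ => f^[n]) U}

/-- The Julia set: the complement of the Fatou set. -/
def juliaSet (f : ℂ → ℂ) : Set ℂ :=
  (fatouSet f)ᶜ

/-- The maximum modulus `M(r, f) = max_{|z| = r} |f z|`. -/
noncomputable def maxModulus (r : ℝ) (f : ℂ → ℂ) : ℝ :=
  sSup ((fun z => ‖f z‖) '' Metric.sphere (0 : ℂ) r)

end EntireDynamics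

/-! Let H be a half-plane `{ℓ < re}` with `exp ℓ` above all singular values of f. Since H is simply
connected, `f (exp w) = exp z` has a holomorphic solution w = G(z) on H. Together with its
translates by 2πi it gives inverse branches of f in logarithmic coordinates, and J(f) is estimated
from below by the image under `exp` of a Cantor set built from these branches.

Two bounds on G drive the construction. First, far to the right every vertical segment of length 2π
contains a point with |f(exp w)| ≤ `exp ℓ` (otherwise f would be a polynomial). The image of G
therefore contains no large discs there, and Bloch's theorem gives |G'(z)| Re z ≤ const. In
particular Re G(t) = O(log t), so t is exponentially large in Re G(t). Second, the growth hypothesis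
gives log t ≤ (Re G(t))^p with p slightly larger than q. Hence, while Re G runs over an interval of
length comparable to κ near T, log t varies by at most about T^p, so t |G'(t)| is at least of order
κ/T^p for most values of Re G(t).

At such t a three-circles argument yields a disc near t on which G has small distortion and whose
image has size comparable to σ. Its radius is almost comparable to Re t, so the construction can be
repeated inside it. A disc of radius κ thus contains about κ²/σ images of such discs: about κ/σ from
different t, times about κ translates by 2πi. They support a mass of exponent s once σ^(s-1) κ^(2-s)
is large. With κ close to T and σ close to T^(1-q) the exponent of T is close to d = 1 + q - qs,
positive exactly when s < 1 + 1/q.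

Points of the Cantor set escape under f. The large discs they visit contain points that f(exp) sends
into |w| ≤ `exp ℓ`, and the pull-backs of these discs shrink, so no limit function exists and the
points lie in J(f). The main steps are `LogInverse.exists_norm_le_on_segment`,
`exists_disc_small_distortion`, `PieceSystem.le_sum_diam_rpow_of_cover`,
`BoundedLogInverse.exists_children` and `LogPieceSystem.exp_mem_juliaSet`. -/

namespace EntireDynamics

/-! ### Path lifting through local homeomorphisms -/

section PathLifting

variable {E X : Type*} [TopologicalSpace E] {p : E → X} {β : ℝ → X}

/-- `γ` is a continuous lift of `β` through `p` over the set `s`. -/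
def IsLiftOn (p : E → X) (β : ℝ → X) (γ : ℝ → E) (s : Set ℝ) : Prop :=
  ContinuousOn γ s ∧ ∀ t ∈ s, p (γ t) = β t

theorem IsLiftOn.mono {γ : ℝ → E} {s t : Set ℝ} (h : IsLiftOn p β γ t) (hst : s ⊆ t) :
    IsLiftOn p β γ s :=
  ⟨h.1.mono hst, fun x hx => h.2 x (hst hx)⟩

variable [TopologicalSpace X]

theorem IsLiftOn.extend {γ : ℝ → E} {a b : ℝ} (hβ : Continuous β) (ha : 0 ≤ a) (hab : a ≤ b)
    (h : IsLiftOn p β γ (Set.Icc 0 a)) (e : OpenPartialHomeomorph E X) (hs : γ a ∈ e.source)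
    (he : Set.EqOn p e e.source) (ht : ∀ t ∈ Set.Icc a b, β t ∈ e.target) :
    ∃ γ', IsLiftOn p β γ' (Set.Icc 0 b) ∧ γ' 0 = γ 0 := by
  classical
  have hsymm : e.symm (β a) = γ a := by
    rw [← h.2 a ⟨ha, le_rfl⟩, he hs, e.left_inv hs]
  set γ' : ℝ → E := fun t => if t ≤ a then γ t else e.symm (β t) with hγ'
  have h1 : Set.EqOn γ' γ (Set.Icc 0 a) := fun t ht => by simp [hγ', ht.2]
  have h2 : Set.EqOn γ' (fun t => e.symm (β t)) (Set.Icc a b) := fun t ht => by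
    rcases ht.1.eq_or_lt with rfl | hlt
    · simp [hγ', hsymm]
    · simp [hγ', not_le.2 hlt]
  refine ⟨γ', ⟨?_, ?_⟩, h1 ⟨le_rfl, ha⟩⟩
  · rw [← Set.Icc_union_Icc_eq_Icc ha hab]
    refine ContinuousOn.union_of_isClosed (h.1.congr h1) (ContinuousOn.congr ?_ h2)
      isClosed_Icc isClosed_Icc
    exact e.continuousOn_symm.comp hβ.continuousOn ht
  · intro t htb
    rcases le_total t a with hta | hta
    · rw [h1 ⟨htb.1, hta⟩, h.2 t ⟨htb.1, hta⟩]
    · have := ht t ⟨hta, htb.2⟩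
      rw [h2 ⟨hta, htb.2⟩, he (e.map_target this), e.right_inv this]

/-- Path lifting through a local homeomorphism, if partial lifts have cluster points. -/
theorem exists_isLiftOn_of_mapClusterPt [T2Space E] (hp : IsLocalHomeomorph p)
    (hβ : Continuous β) {e₀ : E} (h0 : p e₀ = β 0)
    (hlim : ∀ σ > 0, ∀ γ : ℝ → E, IsLiftOn p β γ (Set.Ico 0 σ) →
      ∃ e, MapClusterPt e (𝓝[Set.Ico 0 σ] σ) γ ∧ p e = β σ) (s : ℝ) :
    ∃ γ, IsLiftOn p β γ (Set.Icc 0 s) ∧ γ 0 = e₀ := by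
  set P : ℝ → Prop := fun s => ∃ γ, IsLiftOn p β γ (Set.Icc 0 s) ∧ γ 0 = e₀ with hP
  have hmono : ∀ s t, s ≤ t → P t → P s := fun s t hst ⟨γ, h, h'⟩ =>
    ⟨γ, h.mono (Set.Icc_subset_Icc_right hst), h'⟩
  have huniq : ∀ γ γ' s, IsLiftOn p β γ (Set.Icc 0 s) → IsLiftOn p β γ' (Set.Icc 0 s) →
      γ 0 = e₀ → γ' 0 = e₀ → Set.EqOn γ γ' (Set.Icc 0 s) := by
    intro γ γ' s h h' h0 h0' t ht
    refine (T2Space.isSeparatedMap p).eqOn_of_comp_eqOn hp.isLocallyInjective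
      isPreconnected_Icc h.1 h'.1 (fun t ht => ?_) (a := 0) ⟨le_rfl, ht.1.trans ht.2⟩
      (h0.trans h0'.symm) ht
    simp [h.2 t ht, h'.2 t ht]
  have hstep : ∀ s (e : OpenPartialHomeomorph E X), β s ∈ e.target → ∃ δ > 0,
      ∀ t, |t - s| ≤ δ → β t ∈ e.target := by
    intro s e hs
    have := hβ.continuousAt.eventually (e.open_target.mem_nhds hs)
    obtain ⟨δ, hδ, h⟩ := Metric.eventually_nhds_iff.1 this
    refine ⟨δ / 2, by positivity, fun t ht => h ?_⟩
    rw [Real.dist_eq]; linarith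
  have hP0 : P 0 := ⟨fun _ => e₀, ⟨continuousOn_const, fun t ht => by
    have : t = 0 := le_antisymm ht.2 ht.1
    rw [this, h0]⟩, rfl⟩
  by_contra hns
  set S : Set ℝ := {t | 0 ≤ t ∧ P t} with hS
  have hSne : S.Nonempty := ⟨0, le_rfl, hP0⟩
  have hSb : BddAbove S := ⟨s, fun t ht => by
    by_contra hlt
    exact hns (hmono s t (not_le.1 hlt).le ht.2)⟩
  set σ := sSup S with hσ
  have hlt : ∀ t, t < σ → P t := fun t ht => by
    obtain ⟨u, hu, hut⟩ := exists_lt_of_lt_csSup hSne ht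
    exact hmono t u hut.le hu.2
  have hgt : ∀ t, σ < t → ¬ P t := fun t ht hPt => by
    have h0σ : 0 ≤ σ := le_csSup hSb ⟨le_rfl, hP0⟩
    exact absurd (le_csSup hSb (show t ∈ S from ⟨h0σ.trans ht.le, hPt⟩)) (not_le.2 ht)
  have hσ0 : 0 < σ := by
    obtain ⟨e, hes, hee⟩ := hp e₀
    have hpe : Set.EqOn p e e.source := fun x _ => by rw [hee]
    obtain ⟨δ, hδ, hδt⟩ := hstep 0 e (by rw [← h0, hpe hes]; exact e.map_source hes)
    obtain ⟨γ, hγ, hγ0⟩ := hP0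
    obtain ⟨γ', h1, h2⟩ := hγ.extend hβ le_rfl hδ.le e (by rwa [hγ0]) hpe
      (fun t ht => hδt t (by rw [sub_zero, abs_of_nonneg ht.1]; exact ht.2))
    exact hδ.trans_le (le_csSup hSb ⟨hδ.le, γ', h1, h2.trans hγ0⟩)
  have : Nonempty E := ⟨e₀⟩
  choose! Γ hΓ hΓ0 using hlt
  -- The lift used at t is defined up to the midpoint of t and σ, hence on both sides of t. This
  -- gives continuity of the glued lift at t.
  set γ : ℝ → E := fun t => Γ ((t + σ) / 2) t with hγ
  have hγeq : ∀ s < σ, Set.EqOn γ (Γ s) (Set.Icc 0 s) := by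
    intro s hs t ht
    have h1 : (t + σ) / 2 < σ := by linarith [ht.2]
    rcases le_total s ((t + σ) / 2) with h | h
    · exact huniq _ _ s ((hΓ _ h1).mono (Set.Icc_subset_Icc_right h)) (hΓ s hs) (hΓ0 _ h1)
        (hΓ0 s hs) ht
    · exact huniq _ _ _ (hΓ _ h1) ((hΓ s hs).mono (Set.Icc_subset_Icc_right h)) (hΓ0 _ h1)
        (hΓ0 s hs) ⟨ht.1, by linarith [ht.2]⟩
  have hγl : IsLiftOn p β γ (Set.Ico 0 σ) := by
    refine ⟨fun t ht => ?_, fun t ht => ?_⟩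
    · have h1 : (t + σ) / 2 < σ := by linarith [ht.2]
      have h2 : t < (t + σ) / 2 := by linarith [ht.2]
      have := ((hΓ _ h1).1.congr (hγeq _ h1)) t ⟨ht.1, h2.le⟩
      refine this.mono_of_mem_nhdsWithin ?_
      filter_upwards [self_mem_nhdsWithin, mem_nhdsWithin_of_mem_nhds (Iio_mem_nhds h2)]
        with u hu hu'
      exact ⟨hu.1, le_of_lt hu'⟩
    · rw [hγeq t ht.2 ⟨ht.1, le_rfl⟩]
      exact (hΓ t ht.2).2 t ⟨ht.1, le_rfl⟩
  -- A cluster point is enough: the lift enters the chart at e₁ at some time just before σ, and from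
  -- there the local inverse carries it beyond σ.
  obtain ⟨e₁, hcl, hpe₁⟩ := hlim σ hσ0 γ hγl
  obtain ⟨e, hes, hee⟩ := hp e₁
  have hpe : Set.EqOn p e e.source := fun x _ => by rw [hee]
  obtain ⟨δ, hδ, hδt⟩ := hstep σ e (by rw [← hpe₁, hpe hes]; exact e.map_source hes)
  have hfr := hcl.frequently (e.open_source.mem_nhds hes)
  have hev : ∀ᶠ t in 𝓝[Set.Ico 0 σ] σ, t ∈ Set.Ico 0 σ ∧ σ - δ < t :=
    (eventually_mem_nhdsWithin).and
      (mem_nhdsWithin_of_mem_nhds (Ioi_mem_nhds (by linarith)))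
  obtain ⟨t, hte, htσ, htδ⟩ := (hfr.and_eventually hev).exists
  have hγ0 : γ 0 = e₀ := by
    rw [hγeq t htσ.2 ⟨le_rfl, htσ.1⟩, hΓ0 t htσ.2]
  obtain ⟨γ', h1, h2⟩ := IsLiftOn.extend hβ htσ.1 (show t ≤ σ + δ by linarith [htσ.2])
    (hγl.mono fun u hu => ⟨hu.1, hu.2.trans_lt htσ.2⟩) e hte hpe
    (fun u hu => hδt u (by rw [abs_le]; constructor <;> linarith [hu.1, hu.2]))
  exact hgt (σ + δ) (by linarith) ⟨γ', h1, h2.trans hγ0⟩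

end PathLifting

end EntireDynamics

/-! ### Construction of an inverse branch in logarithmic coordinates -/

namespace EntireDynamics

/-- `G` is a holomorphic inverse branch of `z ↦ f (exp z)` in logarithmic coordinates: it maps the
half-plane `{ℓ < re}` into the right half-plane and satisfies `f (exp (G z)) = exp z`. -/
structure LogInverse (f : ℂ → ℂ) (ℓ : ℝ) (G : ℂ → ℂ) : Prop where
  entire : Differentiable ℂ f
  pos : 0 < ℓ
  deriv_ne_zero : ∀ z, Real.exp ℓ < ‖f z‖ → deriv f z ≠ 0
  differentiableOn : DifferentiableOn ℂ G {z | ℓ < z.re}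
  map_exp : ∀ z, ℓ < z.re → f (Complex.exp (G z)) = Complex.exp z
  re_pos : ∀ z, ℓ < z.re → 0 < (G z).re

theorem isOpen_re_gt (ℓ : ℝ) : IsOpen {z : ℂ | ℓ < z.re} :=
  isOpen_lt continuous_const Complex.continuous_re

theorem convex_re_gt (ℓ : ℝ) : Convex ℝ {z : ℂ | ℓ < z.re} :=
  convex_halfSpace_re_gt ℓ

theorem isLocalHomeomorph_domRestrict {f : ℂ → ℂ} (hf : Differentiable ℂ f) {R : ℝ}
    (hd : ∀ z, R < ‖f z‖ → deriv f z ≠ 0) :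
    IsLocalHomeomorph (fun z : {z : ℂ // R < ‖f z‖} => f z) := by
  have hopen : IsOpen {z : ℂ | R < ‖f z‖} := isOpen_lt continuous_const hf.continuous.norm
  have h1 : IsLocalHomeomorphOn f {z : ℂ | R < ‖f z‖} := by
    refine IsLocalHomeomorphOn.mk f _ fun z hz => ?_
    have hs : HasStrictDerivAt f (deriv f z) z := (hf.analyticAt z).hasStrictDerivAt
    exact ⟨(hs.hasStrictFDerivAt_equiv (hd z hz)).toOpenPartialHomeomorph f,
      HasStrictFDerivAt.mem_toOpenPartialHomeomorph_source _, fun x _ => rfl⟩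
  have h2 := (hopen.isOpenEmbedding_subtypeVal.isLocalHomeomorph)
  rw [isLocalHomeomorph_iff_isLocalHomeomorphOn_univ] at h2 ⊢
  exact h1.comp h2 fun z _ => z.2

/-- A continuous solution `u` of `p (u z) = h z` is holomorphic where `p' (u z) ≠ 0`. -/
theorem differentiableAt_of_comp_eq {p h u : ℂ → ℂ} {z : ℂ} (hu : ContinuousAt u z)
    (hp : AnalyticAt ℂ p (u z)) (hp' : deriv p (u z) ≠ 0) (hh : DifferentiableAt ℂ h z)
    (heq : ∀ᶠ w in 𝓝 z, p (u w) = h w) : DifferentiableAt ℂ u z := by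
  have hs := hp.hasStrictDerivAt
  have h1 := hu.eventually (hs.eventually_left_inverse hp')
  have h2 : (fun w => hs.localInverse p _ _ hp' (h w)) =ᶠ[𝓝 z] u := by
    filter_upwards [h1, heq] with w h1 h2
    rw [← h2, h1]
  refine DifferentiableAt.congr_of_eventuallyEq ?_ h2.symm
  have h3 : DifferentiableAt ℂ (hs.localInverse p _ _ hp') (h z) := by
    rw [← heq.self_of_nhds]
    exact (hs.to_localInverse hp').hasDerivAt.differentiableAt
  exact h3.comp z hh

/-- Paths in `{R < ‖·‖}` lift through an entire function without singular values there. -/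
theorem exists_isLiftOn_entire {f : ℂ → ℂ} (hf : Differentiable ℂ f) {R : ℝ}
    (hd : ∀ z, R < ‖f z‖ → deriv f z ≠ 0) (ha : ∀ a ∈ asymptoticValues f, ‖a‖ ≤ R)
    {β : ℝ → ℂ} (hβ : Continuous β) (hR : ∀ t, R < ‖β t‖) (z₀ : {z : ℂ // R < ‖f z‖})
    (h0 : f z₀ = β 0) (s : ℝ) :
    ∃ γ, IsLiftOn (fun z : {z : ℂ // R < ‖f z‖} => f z) β γ (Set.Icc 0 s) ∧ γ 0 = z₀ := by
  refine exists_isLiftOn_of_mapClusterPt (isLocalHomeomorph_domRestrict hf hd) hβ h0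
    (fun σ hσ γ hγ => ?_) s
  have hopen : IsOpen {z : ℂ | R < ‖f z‖} := isOpen_lt continuous_const hf.continuous.norm
  have hcont : ContinuousOn (fun t => (γ t : ℂ)) (Set.Ico 0 σ) :=
    continuous_subtype_val.comp_continuousOn hγ.1
  -- A partial lift running off to ∞ would, after reparametrising [0, σ) by [0, ∞), be an asymptotic
  -- path with asymptotic value β(σ), whose modulus exceeds R.
  have hnot : ¬ Tendsto (fun t => ‖(γ t : ℂ)‖) (𝓝[Set.Ico 0 σ] σ) atTop := by
    intro hT
    refine absurd (ha (β σ) ?_) (not_le.2 (hR σ))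
    set u : ℝ → ℝ := fun x => σ - σ / (1 + x) with hu
    have hu0 : Tendsto u atTop (𝓝 σ) := by
      have : Tendsto (fun x : ℝ => σ / (1 + x)) atTop (𝓝 0) :=
        tendsto_const_nhds.div_atTop (tendsto_atTop_add_const_left _ _ tendsto_id)
      simpa [hu] using tendsto_const_nhds.sub this
    have hum : ∀ x ∈ Set.Ici (0 : ℝ), u x ∈ Set.Ico 0 σ := by
      intro x hx
      have hx' : (0 : ℝ) < 1 + x := by have := Set.mem_Ici.1 hx; linarith
      refine ⟨?_, ?_⟩
      · have : σ / (1 + x) ≤ σ := div_le_self hσ.le (by have := Set.mem_Ici.1 hx; linarith)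
        simp only [hu]; linarith
      · have : 0 < σ / (1 + x) := by positivity
        simp only [hu]; linarith
    have huT : Tendsto u atTop (𝓝[Set.Ico 0 σ] σ) :=
      tendsto_nhdsWithin_iff.2 ⟨hu0, (eventually_ge_atTop 0).mono hum⟩
    refine ⟨fun x => γ (u x), hcont.comp ?_ hum, hT.comp huT, ?_⟩
    · refine continuousOn_const.sub (continuousOn_const.div (by fun_prop) ?_)
      intro x hx
      have := Set.mem_Ici.1 hx; positivity
    · refine ((hβ.tendsto σ).comp hu0).congr' ?_
      filter_upwards [eventually_ge_atTop 0] with x hx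
      exact (hγ.2 _ (hum x hx)).symm
  obtain ⟨M, hM⟩ : ∃ M, ∃ᶠ t in 𝓝[Set.Ico 0 σ] σ, ‖(γ t : ℂ)‖ ≤ M := by
    by_contra hcon
    refine hnot (tendsto_atTop.2 fun M => ?_)
    have := not_exists.1 hcon M
    rw [not_frequently] at this
    exact this.mono fun t ht => (not_le.1 ht).le
  obtain ⟨z, -, hz⟩ := (isCompact_closedBall (0 : ℂ) M).exists_mapClusterPt_of_frequently
    (hM.mono fun t ht => by simpa using ht)
  have hfz : f z = β σ := by
    have h1 : MapClusterPt (f z) (𝓝[Set.Ico 0 σ] σ) (f ∘ fun t => (γ t : ℂ)) :=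
      hz.tendsto_comp (hf.continuous.tendsto z)
    have h2 : Tendsto (f ∘ fun t => (γ t : ℂ)) (𝓝[Set.Ico 0 σ] σ) (𝓝 (β σ)) := by
      refine ((hβ.tendsto σ).mono_left nhdsWithin_le_nhds).congr' ?_
      filter_upwards [self_mem_nhdsWithin] with t ht
      exact (hγ.2 t ht).symm
    by_contra hne
    obtain ⟨U, V, hU, hV, hUV⟩ := t2_separation_nhds hne
    obtain ⟨t, h3, h4⟩ := ((h1.frequently (eventually_mem_set.2 hU)).and_eventually
      (h2.eventually hV)).exists
    exact Set.disjoint_left.1 hUV h3 h4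
  refine ⟨⟨z, by rw [hfz]; exact hR σ⟩, ?_, hfz⟩
  rw [mapClusterPt_iff_frequently]
  intro s hs
  have := hopen.isOpenEmbedding_subtypeVal.isOpenMap.image_mem_nhds hs
  refine (hz.frequently (eventually_mem_set.2 this)).mono ?_
  rintro t ⟨w, hw, hwt⟩
  rwa [Subtype.ext hwt] at hw

/-- A function of class `B` has a holomorphic inverse branch in logarithmic coordinates. -/
theorem ClassB.exists_logInverse {f : ℂ → ℂ} (hf : ClassB f) : ∃ ℓ G, LogInverse f ℓ G := by
  obtain ⟨⟨hd, hpoly⟩, hb⟩ := hf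
  obtain ⟨R₀, hR₀⟩ := hb.exists_norm_le
  obtain ⟨R₁, hR₁⟩ := (isCompact_closedBall (0 : ℂ) 1).exists_bound_of_continuousOn
    hd.continuous.continuousOn
  -- R₀ bounds the singular values. R₁ bounds |f| on the unit disc, which forces the lifted points
  -- outside that disc and so makes the real part of the logarithm positive.
  set ℓ : ℝ := max R₀ R₁ ⊔ 1 with hℓ
  have hℓe : ℓ < Real.exp ℓ := by linarith [Real.add_one_le_exp ℓ]
  have hℓ0 : 0 < ℓ := lt_of_lt_of_le one_pos (le_max_right _ _)
  have hle₀ : R₀ < Real.exp ℓ := ((le_max_left _ _).trans (le_max_left _ _)).trans_lt hℓe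
  have hle₁ : R₁ < Real.exp ℓ := ((le_max_right _ _).trans (le_max_left _ _)).trans_lt hℓe
  have hder : ∀ z, Real.exp ℓ < ‖f z‖ → deriv f z ≠ 0 := fun z hz h0 =>
    absurd (hR₀ (f z) (Or.inl ⟨z, h0, rfl⟩)) (not_le.2 (hle₀.trans hz))
  have hasy : ∀ a ∈ asymptoticValues f, ‖a‖ ≤ Real.exp ℓ := fun a ha =>
    (hR₀ a (Or.inr ha)).trans hle₀.le
  obtain ⟨z₀, hz₀⟩ : ∃ z₀, Real.exp ℓ < ‖f z₀‖ := by
    by_contra hcon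
    push Not at hcon
    refine hpoly ⟨Polynomial.C (f 0), fun z => ?_⟩
    rw [Polynomial.eval_C]
    refine hd.apply_eq_apply_of_bounded ?_ z 0
    exact isBounded_iff_forall_norm_le.2 ⟨Real.exp ℓ, by rintro _ ⟨z, rfl⟩; exact hcon z⟩
  set H : Set ℂ := {z | ℓ < z.re} with hH
  have hHo : IsOpen H := isOpen_re_gt ℓ
  have hHc : Convex ℝ H := convex_re_gt ℓ
  have hexpH : ∀ z ∈ H, Real.exp ℓ < ‖Complex.exp z‖ := fun z hz => by
    rw [Complex.norm_exp]; exact Real.exp_lt_exp.2 hz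
  set ζ₀ : ℂ := Complex.log (f z₀) with hζ₀
  have hfz₀ : f z₀ ≠ 0 := norm_pos_iff.1 ((Real.exp_pos ℓ).trans hz₀)
  have heζ₀ : Complex.exp ζ₀ = f z₀ := Complex.exp_log hfz₀
  have hζ₀H : ζ₀ ∈ H := by
    have : Real.exp ℓ < Real.exp ζ₀.re := by rw [← Complex.norm_exp, heζ₀]; exact hz₀
    exact Real.exp_lt_exp.1 this
  have hseg : ∀ ζ ∈ H, ∀ t ∈ Set.Icc (0 : ℝ) 1, ζ₀ + t * (ζ - ζ₀) ∈ H := by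
    intro ζ hζ t ht
    have := hHc.add_smul_sub_mem hζ₀H hζ ht
    simpa using this
  -- Clamping t to [0, 1] keeps the path in the exterior region for every real t.
  set β : ℂ → ℝ → ℂ := fun ζ t =>
    Complex.exp (ζ₀ + (Set.projIcc (0 : ℝ) 1 zero_le_one t : ℝ) * (ζ - ζ₀)) with hβ
  have hlift : ∀ ζ : H, ∃ γ, IsLiftOn (fun z : {z : ℂ // Real.exp ℓ < ‖f z‖} => f z) (β ζ) γ
      (Set.Icc 0 1) ∧ γ 0 = ⟨z₀, hz₀⟩ := by
    intro ζ
    refine exists_isLiftOn_entire hd hder hasy ?_ ?_ ⟨z₀, hz₀⟩ ?_ 1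
    · have := (continuous_projIcc (h := zero_le_one (α := ℝ)))
      simp only [hβ]
      fun_prop
    · exact fun t => hexpH _ (hseg ζ ζ.2 _ (Set.projIcc (0 : ℝ) 1 zero_le_one t).2)
    · simp [hβ, heζ₀]
  choose Γ hΓ hΓ0 using hlift
  set g : unitInterval × H → {z : ℂ // Real.exp ℓ < ‖f z‖} := fun x => Γ x.2 x.1 with hg
  -- Lifts along the segments from ζ₀ with a common starting point depend continuously on the
  -- endpoint as well (homotopy lifting).
  have hgc : Continuous g := by
    refine (isLocalHomeomorph_domRestrict hd hder).continuous_lift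
      (T2Space.isSeparatedMap _)
      ⟨fun x : unitInterval × H => Complex.exp (ζ₀ + (x.1 : ℝ) * ((x.2 : ℂ) - ζ₀)), by fun_prop⟩
      ?_ ?_ ?_
    · funext x
      have h1 := (hΓ x.2).2 x.1 x.1.2
      simp only [Function.comp_apply, hg, ContinuousMap.coe_mk]
      refine h1.trans ?_
      simp [hβ]
    · simp only [hg, Set.Icc.coe_zero, hΓ0]
      exact continuous_const
    · intro ζ
      exact (hΓ ζ).1.comp_continuous continuous_subtype_val fun t => t.2
  set Ψ : ℂ → ℂ := fun ζ => if h : ζ ∈ H then (g (1, ⟨ζ, h⟩) : ℂ) else 0 with hΨ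
  have hΨc : ContinuousOn Ψ H := by
    rw [continuousOn_iff_continuous_domRestrict]
    have : H.domRestrict Ψ = fun ζ => (g (1, ζ) : ℂ) := by
      funext ζ
      simp [Set.domRestrict, hΨ]
    rw [this]
    exact continuous_subtype_val.comp (hgc.comp (by fun_prop))
  have hfΨ : ∀ ζ ∈ H, f (Ψ ζ) = Complex.exp ζ := by
    intro ζ hζ
    have h1 := (hΓ ⟨ζ, hζ⟩).2 1 ⟨zero_le_one, le_rfl⟩
    simp only [hΨ, hζ, dif_pos, hg, Set.Icc.coe_one]
    refine h1.trans ?_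
    simp [hβ]
  have hΨ1 : ∀ ζ ∈ H, 1 < ‖Ψ ζ‖ := by
    intro ζ hζ
    by_contra hle
    have := hR₁ (Ψ ζ) (by simpa using not_lt.1 hle)
    rw [hfΨ ζ hζ] at this
    linarith [hexpH ζ hζ]
  have hsc : IsSimplyConnected H := by
    have := hHc.contractibleSpace ⟨ζ₀, hζ₀H⟩
    exact (inferInstance : SimplyConnectedSpace H)
  obtain ⟨G, hGc, hG⟩ := Complex.exists_continuousOn_eqOn_exp_comp hsc hHo hΨc (by
    rintro ⟨ζ, hζ, h0⟩
    have := hΨ1 ζ hζ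
    rw [h0, norm_zero] at this
    linarith)
  have hmap : ∀ z ∈ H, f (Complex.exp (G z)) = Complex.exp z := fun z hz => by
    rw [show Complex.exp (G z) = Ψ z from hG hz, hfΨ z hz]
  refine ⟨ℓ, G, hd, hℓ0, hder, fun z hz => ?_, hmap, fun z hz => ?_⟩
  · refine (differentiableAt_of_comp_eq (p := fun w => f (Complex.exp w)) (h := Complex.exp)
      (hGc.continuousAt (hHo.mem_nhds hz)) ?_ ?_ Complex.differentiable_exp.differentiableAt
      ?_).differentiableWithinAt
    · exact (hd.comp Complex.differentiable_exp).analyticAt _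
    · rw [show (fun w => f (Complex.exp w)) = f ∘ Complex.exp from rfl,
        deriv_comp _ hd.differentiableAt Complex.differentiable_exp.differentiableAt,
        Complex.deriv_exp]
      refine mul_ne_zero (hder _ ?_) (Complex.exp_ne_zero _)
      rw [hmap z hz]
      exact hexpH z hz
    · filter_upwards [hHo.mem_nhds hz] with w hw using hmap w hw
  · have := hΨ1 z hz
    rw [← hG hz, Function.comp_apply, Complex.norm_exp] at this
    exact Real.one_lt_exp_iff.1 this

end EntireDynamics

/-! ### The image of the branch contains no vertical line far to the right -/

namespace EntireDynamics

/-- An entire function with polynomial growth on arbitrarily large circles is a polynomial. -/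
theorem exists_polynomial_of_growth {f : ℂ → ℂ} (hf : Differentiable ℂ f) {C : ℝ} {N : ℕ}
    (h : ∀ r₀ : ℝ, ∃ r, r₀ ≤ r ∧ ∀ z, ‖z‖ = r → ‖f z‖ ≤ C * r ^ N) :
    ∃ p : Polynomial ℂ, ∀ z, f z = p.eval z := by
  have hz : ∀ n, N < n → iteratedDeriv n f 0 = 0 := by
    intro n hn
    by_contra hne
    have hpos : 0 < ‖iteratedDeriv n f 0‖ := norm_pos_iff.2 hne
    -- With this r, Cauchy's estimate n! |C| r^N / r^n ≤ n! |C| / r falls below the supposed nonzero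
    -- derivative.
    obtain ⟨r, hr, hb⟩ := h (max 1 (n.factorial * |C| / ‖iteratedDeriv n f 0‖ + 1))
    have hr1 : 1 ≤ r := (le_max_left _ _).trans hr
    have hr2 : n.factorial * |C| / ‖iteratedDeriv n f 0‖ + 1 ≤ r := (le_max_right _ _).trans hr
    have hr0 : 0 < r := by linarith
    have h1 := Complex.norm_iteratedDeriv_le_of_forall_mem_sphere_norm_le (c := 0) n hr0
      hf.diffContOnCl (C := |C| * r ^ N) (fun z hz => by
        refine (hb z (by simpa using hz)).trans ?_
        gcongr; exact le_abs_self C)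
    have h2 : r ^ N * r ≤ r ^ n := by
      rw [← pow_succ]; exact pow_le_pow_right₀ hr1 hn
    have h3 : n.factorial * (|C| * r ^ N) / r ^ n ≤ n.factorial * |C| / r := by
      rw [div_le_div_iff₀ (by positivity) hr0]
      have : 0 ≤ n.factorial * |C| := by positivity
      nlinarith
    have h4 : n.factorial * |C| / ‖iteratedDeriv n f 0‖ < r := by linarith
    rw [div_lt_iff₀ hpos] at h4
    have h5 := h1.trans h3
    rw [le_div_iff₀ hr0] at h5
    linarith
  refine ⟨∑ n ∈ Finset.range (N + 1), Polynomial.C ((n.factorial : ℂ)⁻¹ * iteratedDeriv n f 0) *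
    Polynomial.X ^ n, fun z => ?_⟩
  rw [← Complex.taylorSeries_eq_of_entire' 0 z hf, tsum_eq_sum (s := Finset.range (N + 1)),
    Polynomial.eval_finsetSum]
  · simp
  · intro n hn
    rw [Finset.mem_range, not_lt] at hn
    rw [hz n hn]; simp

namespace LogInverse

variable {f G : ℂ → ℂ} {ℓ : ℝ}

theorem differentiable_comp_exp (h : LogInverse f ℓ G) :
    Differentiable ℂ (fun w => f (Complex.exp w)) :=
  h.entire.comp Complex.differentiable_exp

theorem deriv_comp_exp_ne_zero (h : LogInverse f ℓ G) (w : ℂ)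
    (hw : Real.exp ℓ < ‖f (Complex.exp w)‖) : deriv (fun w => f (Complex.exp w)) w ≠ 0 := by
  rw [show (fun w => f (Complex.exp w)) = f ∘ Complex.exp from rfl,
    deriv_comp _ h.entire.differentiableAt Complex.differentiable_exp.differentiableAt,
    Complex.deriv_exp]
  exact mul_ne_zero (h.deriv_ne_zero _ hw) (Complex.exp_ne_zero _)

theorem differentiableAt (h : LogInverse f ℓ G) {z : ℂ} (hz : ℓ < z.re) :
    DifferentiableAt ℂ G z :=
  h.differentiableOn.differentiableAt ((isOpen_re_gt ℓ).mem_nhds hz)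

theorem lt_norm_map_exp (h : LogInverse f ℓ G) {z : ℂ} (hz : ℓ < z.re) :
    Real.exp ℓ < ‖f (Complex.exp (G z))‖ := by
  rw [h.map_exp z hz, Complex.norm_exp]; exact Real.exp_lt_exp.2 hz

/-- Over the exterior region `f ∘ exp` is a local homeomorphism, hence locally injective, so the set
where two lifts agree is both open and closed. -/
theorem lift_unique (h : LogInverse f ℓ G) {A : Type*} [TopologicalSpace A] {s : Set A}
    (hs : IsPreconnected s) {u v : A → ℂ} (hu : ContinuousOn u s) (hv : ContinuousOn v s)
    (huv : ∀ a ∈ s, f (Complex.exp (u a)) = f (Complex.exp (v a)))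
    (hR : ∀ a ∈ s, Real.exp ℓ < ‖f (Complex.exp (u a))‖) {a₀ : A} (ha₀ : a₀ ∈ s)
    (h0 : u a₀ = v a₀) : Set.EqOn u v s := by
  have hloc := isLocalHomeomorph_domRestrict h.differentiable_comp_exp h.deriv_comp_exp_ne_zero
  have := isPreconnected_iff_preconnectedSpace.1 hs
  let u' : s → {w : ℂ // Real.exp ℓ < ‖f (Complex.exp w)‖} := fun a => ⟨u a, hR a a.2⟩
  let v' : s → {w : ℂ // Real.exp ℓ < ‖f (Complex.exp w)‖} :=
    fun a => ⟨v a, huv a a.2 ▸ hR a a.2⟩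
  have hu' : Continuous u' := (continuousOn_iff_continuous_domRestrict.1 hu).subtype_mk _
  have hv' : Continuous v' := (continuousOn_iff_continuous_domRestrict.1 hv).subtype_mk _
  have key : u' = v' := (T2Space.isSeparatedMap _).eq_of_comp_eq hloc.isLocallyInjective hu' hv'
    (funext fun a => huv a a.2) ⟨a₀, ha₀⟩ (Subtype.ext h0)
  intro a ha
  exact congrArg Subtype.val (congrFun key ⟨a, ha⟩)

/-- Near w there is a branch λ of log f(exp) with values in the half-plane, normalised by λ(G ζ) = ζ
at a nearby point G ζ of the image. By uniqueness of lifts G ∘ λ is the identity on a ball around w.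
Thus the image of G is open, and closed relative to the region where |f ∘ exp| > `exp ℓ`. -/
theorem image_mem_nhds_of_mem_closure (h : LogInverse f ℓ G) {w : ℂ}
    (hw : w ∈ closure (G '' {z | ℓ < z.re})) (hR : Real.exp ℓ < ‖f (Complex.exp w)‖) :
    G '' {z | ℓ < z.re} ∈ 𝓝 w := by
  set p : ℂ → ℂ := fun w => f (Complex.exp w) with hp
  have hpc : Continuous p := h.differentiable_comp_exp.continuous
  set c := p w with hc
  have hc0 : 0 < ‖c‖ := (Real.exp_pos ℓ).trans hR
  have hev : ∀ᶠ x in 𝓝 w, p x ∈ Metric.ball c (‖c‖ - Real.exp ℓ) :=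
    hpc.continuousAt.eventually (Metric.ball_mem_nhds _ (by linarith))
  obtain ⟨δ, hδ, hball⟩ := Metric.eventually_nhds_iff_ball.1 hev
  have hlt : ∀ x ∈ Metric.ball w δ, Real.exp ℓ < ‖p x‖ := by
    intro x hx
    have h1 := hball x hx
    rw [Metric.mem_ball, dist_comm, dist_eq_norm] at h1
    have := norm_le_insert' c (p x)
    linarith
  have hslit : ∀ x ∈ Metric.ball w δ, p x / c ∈ Complex.slitPlane := by
    intro x hx
    have h1 := hball x hx
    rw [Metric.mem_ball, dist_eq_norm] at h1
    have h2 : ‖p x / c - 1‖ < 1 := by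
      rw [div_sub_one (norm_pos_iff.1 hc0), norm_div, div_lt_one hc0]
      linarith [Real.exp_pos ℓ]
    have := Complex.mem_slitPlane_of_norm_lt_one h2
    simpa using this
  obtain ⟨_, ⟨ζ, hζ, rfl⟩, hζw⟩ := Metric.mem_closure_iff.1 hw δ hδ
  rw [dist_comm] at hζw
  set lam : ℂ → ℂ := fun x => Complex.log (p x / c) - Complex.log (p (G ζ) / c) + ζ with hlam
  have hexp : ∀ x ∈ Metric.ball w δ, Complex.exp (lam x) = p x := by
    intro x hx
    have hcn : c ≠ 0 := norm_pos_iff.1 hc0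
    have hx0 : p x ≠ 0 := norm_pos_iff.1 ((Real.exp_pos ℓ).trans (hlt x hx))
    have hG0 : p (G ζ) ≠ 0 := norm_pos_iff.1 ((Real.exp_pos ℓ).trans (hlt _ hζw))
    rw [hlam]
    simp only
    rw [Complex.exp_add, Complex.exp_sub, Complex.exp_log (div_ne_zero hx0 hcn),
      Complex.exp_log (div_ne_zero hG0 hcn), ← h.map_exp ζ hζ]
    change p x / c / (p (G ζ) / c) * p (G ζ) = p x
    field_simp
  have hre : ∀ x ∈ Metric.ball w δ, ℓ < (lam x).re := by
    intro x hx
    have := hlt x hx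
    rw [← hexp x hx, Complex.norm_exp] at this
    exact Real.exp_lt_exp.1 this
  have hlc : ContinuousOn lam (Metric.ball w δ) := by
    refine (ContinuousOn.sub (ContinuousOn.clog ?_ hslit) continuousOn_const).add
      continuousOn_const
    exact (hpc.div_const c).continuousOn
  have hEq : Set.EqOn (fun x => G (lam x)) id (Metric.ball w δ) := by
    refine h.lift_unique (convex_ball w δ).isPreconnected
      (h.differentiableOn.continuousOn.comp hlc hre) continuousOn_id (fun x hx => ?_)
      (fun x hx => h.lt_norm_map_exp (hre x hx)) (a₀ := G ζ) hζw ?_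
    · rw [h.map_exp _ (hre x hx), hexp x hx]; rfl
    · simp [hlam]
  refine mem_of_superset (Metric.ball_mem_nhds w hδ) fun x hx => ⟨lam x, hre x hx, hEq hx⟩

theorem subset_image_of_isPreconnected (h : LogInverse f ℓ G) {s : Set ℂ} (hs : IsPreconnected s)
    (hR : ∀ w ∈ s, Real.exp ℓ < ‖f (Complex.exp w)‖) {ζ : ℂ} (hζ : ℓ < ζ.re) (hζs : G ζ ∈ s) :
    s ⊆ G '' {z | ℓ < z.re} := by
  refine hs.subset_of_closure_inter_subset ?_ ⟨G ζ, hζs, ζ, hζ, rfl⟩ ?_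
  · rw [isOpen_iff_mem_nhds]
    rintro _ ⟨z, hz, rfl⟩
    exact h.image_mem_nhds_of_mem_closure (subset_closure ⟨z, hz, rfl⟩) (h.lt_norm_map_exp hz)
  · rintro w ⟨hw, hws⟩
    exact mem_of_mem_nhds (h.image_mem_nhds_of_mem_closure hw (hR w hws))

/-- f is bounded on the disc of radius `exp X`, whereas |f(exp(G z))| = exp(Re z). -/
theorem exists_lt_re (h : LogInverse f ℓ G) (X : ℝ) : ∃ T, ℓ < T ∧ ∀ z : ℂ, T ≤ z.re →
    X < (G z).re := by
  obtain ⟨M, hM⟩ := (isCompact_closedBall (0 : ℂ) (Real.exp X)).exists_bound_of_continuousOn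
    h.entire.continuous.continuousOn
  refine ⟨max ℓ M + 1, by linarith [le_max_left ℓ M], fun z hz => ?_⟩
  by_contra hle
  have hzℓ : ℓ < z.re := by linarith [le_max_left ℓ M]
  have h1 := hM (Complex.exp (G z)) (by
    rw [mem_closedBall_zero_iff, Complex.norm_exp]; exact Real.exp_le_exp.2 (not_lt.1 hle))
  rw [h.map_exp z hzℓ, Complex.norm_exp] at h1
  linarith [Real.add_one_le_exp z.re, le_max_right ℓ M]

theorem exists_re_eq (h : LogInverse f ℓ G) {T₀ x : ℝ} (hT₀ : ℓ < T₀)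
    (hx : (G T₀).re ≤ x) : ∃ t : ℝ, T₀ ≤ t ∧ (G t).re = x := by
  obtain ⟨T, hT, hTx⟩ := h.exists_lt_re x
  have hc : ContinuousOn (fun t : ℝ => (G t).re) (Set.Icc T₀ (max T T₀)) := by
    refine Complex.continuous_re.comp_continuousOn (h.differentiableOn.continuousOn.comp
      Complex.continuous_ofReal.continuousOn fun t ht => ?_)
    simpa using hT₀.trans_le ht.1
  obtain ⟨t, ht, hte⟩ := intermediate_value_Icc (le_max_right T T₀) hc
    ⟨hx, (hTx _ (by simp)).le⟩
  exact ⟨t, ht.1, hte⟩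

/-- Harnack's inequality for maps of a half-plane into the right half-plane. -/
theorem norm_sub_le (h : LogInverse f ℓ G) {z w : ℂ} (hw : ‖w‖ < z.re - ℓ) :
    ‖G (z + w) - G z‖ ≤ 2 * (G z).re * ‖w‖ / (z.re - ℓ - ‖w‖) := by
  have hz : ℓ < z.re := by linarith [norm_nonneg w]
  have hmem : ∀ u ∈ Metric.ball (0 : ℂ) (z.re - ℓ), ℓ < (z + u).re := by
    intro u hu
    rw [mem_ball_zero_iff] at hu
    have := (abs_le.1 (Complex.abs_re_le_norm u)).1
    rw [Complex.add_re]; linarith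
  -- The function u ↦ G(z) - G(z + u) vanishes at 0 and has real part less than Re G(z), because Re
  -- G > 0.
  have := Complex.borelCaratheodory_zero (f := fun u => G z - G (z + u)) (M := (G z).re)
    (R := z.re - ℓ) (z := w) (h.re_pos z hz) ?_ ?_ (by linarith) (by simpa using hw) (by simp)
  · rwa [norm_sub_rev]
  · refine (differentiableOn_const _).sub (h.differentiableOn.comp (by fun_prop) hmem)
  · intro u hu
    have := h.re_pos _ (hmem u hu)
    simp only [Set.mem_ofPred_eq, Complex.sub_re]
    linarith

/-- If a vertical line lies in the image of `G`, then `G` is equivariant with respect to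
vertical translations. -/
theorem exists_translation (h : LogInverse f ℓ G) {z z' : ℂ} (hz : ℓ < z.re) (hz' : ℓ < z'.re)
    (heq : G z' = G z + 2 * Real.pi * Complex.I) :
    ∃ k : ℤ, k ≠ 0 ∧ ∀ w : ℂ, ℓ < w.re →
      G (w + k * (2 * Real.pi * Complex.I)) = G w + 2 * Real.pi * Complex.I := by
  have h1 : Complex.exp z' = Complex.exp z := by
    rw [← h.map_exp z' hz', ← h.map_exp z hz, heq, Complex.exp_periodic]
  obtain ⟨k, hk⟩ := Complex.exp_eq_exp_iff_exists_int.1 h1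
  have hre : ∀ w : ℂ, (w + k * (2 * Real.pi * Complex.I)).re = w.re := by
    intro w; simp
  refine ⟨k, ?_, ?_⟩
  · rintro rfl
    have : (2 * Real.pi * Complex.I : ℂ) = 0 := by
      simp [hk] at heq
    exact Complex.two_pi_I_ne_zero this
  · intro w hw
    have hcont : ContinuousOn (fun w => G (w + k * (2 * Real.pi * Complex.I))) {w | ℓ < w.re} :=
      h.differentiableOn.continuousOn.comp (by fun_prop) fun w hw => by
        simpa [hre w] using hw
    refine h.lift_unique (convex_re_gt ℓ).isPreconnected hcont
      (h.differentiableOn.continuousOn.add continuousOn_const) (fun a ha => ?_) (fun a ha => ?_)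
      (a₀ := z) hz ?_ hw
    · rw [h.map_exp _ (by rw [hre]; exact ha), Pi.add_apply, Complex.exp_periodic,
        h.map_exp a ha, Complex.exp_eq_exp_iff_exists_int.2 ⟨k, rfl⟩]
    · exact h.lt_norm_map_exp (by rw [hre]; exact ha)
    · rw [← hk, heq]; rfl

/-- Every long enough vertical segment far to the right contains points where `f ∘ exp` is
bounded. -/
theorem exists_norm_le_on_segment (h : LogInverse f ℓ G)
    (hf : ¬ ∃ p : Polynomial ℂ, ∀ z, f z = p.eval z) :
    ∃ x₀ : ℝ, ∀ w : ℂ, x₀ ≤ w.re → ∃ y ∈ Set.Icc (0 : ℝ) (2 * Real.pi),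
      ‖f (Complex.exp (w + y * Complex.I))‖ ≤ Real.exp ℓ := by
  by_contra hcon
  push Not at hcon
  set T₀ : ℝ := ℓ + 1
  -- A bad segment of length 2π becomes a whole bad vertical line by periodicity of `exp`. The curve
  -- G(t), t real, meets that line, so the line lies in the image of G.
  have hline : ∀ x, (G T₀).re ≤ x → ∃ x' ≥ x, ∀ w : ℂ, w.re = x' →
      w ∈ G '' {z | ℓ < z.re} := by
    intro x hx
    obtain ⟨w₀, hw₀, hlt⟩ := hcon x
    refine ⟨w₀.re, hw₀, ?_⟩
    obtain ⟨t, ht, hte⟩ := h.exists_re_eq (T₀ := T₀) (by simp [T₀]) (hx.trans hw₀)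
    have hconv : Convex ℝ {w : ℂ | w.re = w₀.re} :=
      (convex_singleton w₀.re).is_linear_preimage Complex.reLm.isLinear
    refine h.subset_image_of_isPreconnected hconv.isPreconnected (fun w hw => ?_) (ζ := t)
      (by simp; linarith [show T₀ = ℓ + 1 from rfl]) hte
    obtain ⟨n, hn, -⟩ := existsUnique_add_zsmul_mem_Ico (Real.two_pi_pos) (w.im - w₀.im) 0
    have := hlt _ ⟨hn.1, by simpa using hn.2.le⟩
    have hw' : w = w₀ + (w.im - w₀.im : ℝ) * Complex.I := by
      apply Complex.ext <;> simp [show w.re = w₀.re from hw]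
    have this' : (w₀ + ((w.im - w₀.im + n • (2 * Real.pi) : ℝ) : ℂ) * Complex.I) =
        w + n * (2 * Real.pi * Complex.I) := by
      conv_rhs => rw [hw']
      push_cast [zsmul_eq_mul]; ring
    rwa [this', Complex.exp_eq_exp_iff_exists_int.2 ⟨n, rfl⟩] at this
  obtain ⟨k, hk, hG⟩ : ∃ k : ℤ, k ≠ 0 ∧ ∀ w : ℂ, ℓ < w.re →
      G (w + k * (2 * Real.pi * Complex.I)) = G w + 2 * Real.pi * Complex.I := by
    obtain ⟨x, -, hx⟩ := hline _ le_rfl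
    obtain ⟨z, hz, hzx⟩ := hx x (by simp)
    obtain ⟨z', hz', hzx'⟩ := hx (x + 2 * Real.pi * Complex.I) (by simp)
    exact h.exists_translation hz hz' (by rw [hzx', hzx])
  set κ : ℝ := ‖(k * (2 * Real.pi * Complex.I) : ℂ)‖ with hκ
  have hκ0 : 0 < κ := by
    rw [hκ, norm_pos_iff]
    exact mul_ne_zero (by exact_mod_cast hk) Complex.two_pi_I_ne_zero
  -- A step of length κ in z moves G by exactly 2πi. Harnack's inequality therefore bounds Re G(z)
  -- below linearly in Re z, which makes f of polynomial growth on the corresponding circles.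
  have hgrow : ∀ z : ℂ, ℓ < z.re → z.re ≤ ℓ + 2 * κ + κ * (G z).re := by
    intro z hz
    by_contra hlt
    push Not at hlt
    have hp := h.re_pos z hz
    have h1 : 2 * κ < z.re - ℓ := by nlinarith
    have h2 := h.norm_sub_le (z := z) (w := k * (2 * Real.pi * Complex.I)) (by linarith)
    rw [hG z hz, add_sub_cancel_left, ← hκ, le_div_iff₀ (by linarith)] at h2
    have h3 : (6 : ℝ) ≤ ‖(2 * Real.pi * Complex.I : ℂ)‖ := by
      simp [abs_of_pos Real.pi_pos]; linarith [Real.pi_gt_three]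
    nlinarith
  obtain ⟨N, hN⟩ := exists_nat_ge κ
  refine hf (exists_polynomial_of_growth h.entire (C := Real.exp (ℓ + 2 * κ)) (N := N)
    fun r₀ => ?_)
  obtain ⟨x, hx, hline'⟩ := hline (max (G T₀).re (max r₀ 0)) (le_max_left _ _)
  have hx0 : 0 ≤ x := ((le_max_right _ _).trans (le_max_right _ _)).trans hx
  have hxr : r₀ ≤ x := ((le_max_left _ _).trans (le_max_right _ _)).trans hx
  refine ⟨Real.exp x, by linarith [Real.add_one_le_exp x], fun z hz => ?_⟩
  have hz0 : z ≠ 0 := norm_pos_iff.1 (by rw [hz]; exact Real.exp_pos x)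
  have hzx : (Complex.log z).re = x := by rw [Complex.log_re, hz, Real.log_exp]
  obtain ⟨ζ, hζ, hζz⟩ := hline' _ hzx
  rw [← Complex.exp_log hz0, ← hζz, h.map_exp ζ hζ, Complex.norm_exp, ← Real.exp_nat_mul,
    ← Real.exp_add, Real.exp_le_exp]
  have h1 := hgrow ζ hζ
  rw [hζz, hzx] at h1
  nlinarith

end LogInverse

end EntireDynamics

/-! ### Distortion theorems and the derivative bound -/

namespace EntireDynamics

theorem norm_sub_sub_mul_le {g : ℂ → ℂ} {s : Set ℂ} (hs : Convex ℝ s)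
    (hg : ∀ x ∈ s, DifferentiableAt ℂ g x) {a : ℂ} {ε : ℝ} (hε : ∀ x ∈ s, ‖deriv g x - a‖ ≤ ε)
    {x y : ℂ} (hx : x ∈ s) (hy : y ∈ s) : ‖g x - g y - a * (x - y)‖ ≤ ε * ‖x - y‖ := by
  have h1 : ∀ x ∈ s, HasDerivAt (fun w => g w - a * w) (deriv g x - a) x := fun x hx => by
    simpa using (hg x hx).hasDerivAt.fun_sub ((hasDerivAt_id' x).const_mul a)
  have := hs.norm_image_sub_le_of_norm_deriv_le (f := fun w => g w - a * w) (C := ε)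
    (fun x hx => (h1 x hx).differentiableAt) (fun x hx => by rw [(h1 x hx).deriv]; exact hε x hx)
    hy hx
  rwa [show g x - g y - a * (x - y) = g x - a * x - (g y - a * y) by ring]

/-- A quantitative open mapping theorem of Bloch type. -/
theorem exists_ball_subset_image {g : ℂ → ℂ} {U : Set ℂ} (hU : IsOpen U)
    (hg : DifferentiableOn ℂ g U) {z : ℂ} {h : ℝ} (hh : 0 < h) (hb : Metric.closedBall z h ⊆ U)
    (hz : deriv g z ≠ 0) : ∃ w ∈ Metric.closedBall z h,
      Metric.ball (g w) (h * ‖deriv g z‖ / 48) ⊆ g '' Metric.closedBall z h := by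
  have hdg : DifferentiableOn ℂ (deriv g) U := hg.deriv hU
  -- Landau's device: maximising (distance to the boundary) · |g'| makes |g'| at most 2|g'(w)| on a
  -- ball of half that distance around w.
  obtain ⟨w, hw, hmax⟩ := (isCompact_closedBall z h).exists_isMaxOn
    ⟨z, Metric.mem_closedBall_self hh.le⟩
    (f := fun x => (h - dist x z) * ‖deriv g x‖)
    ((continuousOn_const.sub (continuous_id.dist continuous_const).continuousOn).mul
      (hdg.continuousOn.mono hb).norm)
  have hmax' : ∀ x ∈ Metric.closedBall z h,
      (h - dist x z) * ‖deriv g x‖ ≤ (h - dist w z) * ‖deriv g w‖ := fun x hx => hmax hx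
  set δ := h - dist w z with hδ
  set a := ‖deriv g w‖ with ha
  have hza : h * ‖deriv g z‖ ≤ δ * a := by
    simpa using hmax' z (Metric.mem_closedBall_self hh.le)
  have hz0 : 0 < h * ‖deriv g z‖ := by positivity
  have hδ0 : 0 ≤ δ := sub_nonneg.2 hw
  have hδpos : 0 < δ := by
    rcases hδ0.eq_or_lt with h0 | h0
    · rw [← h0, zero_mul] at hza; linarith
    · exact h0
  have hapos : 0 < a := by
    by_contra hle
    have : a = 0 := le_antisymm (not_lt.1 hle) (norm_nonneg _)
    rw [this, mul_zero] at hza; linarith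
  have hsub : Metric.ball w (δ / 2) ⊆ Metric.closedBall z h := by
    intro x hx
    rw [Metric.mem_ball] at hx
    rw [Metric.mem_closedBall]
    linarith [dist_triangle x w z]
  have hbd : ∀ x ∈ Metric.ball w (δ / 2), ‖deriv g x‖ ≤ 2 * a := by
    intro x hx
    have h1 := hmax' x (hsub hx)
    rw [Metric.mem_ball] at hx
    have h2 : δ / 2 ≤ h - dist x z := by linarith [dist_triangle x w z]
    have h3 : δ / 2 * ‖deriv g x‖ ≤ δ * a :=
      (mul_le_mul_of_nonneg_right h2 (norm_nonneg _)).trans h1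
    nlinarith
  -- Schwarz's lemma for g' - g'(w), bounded by 3a on radius δ/2. The radius δ/12 is what yields
  -- a/2.
  have hsch : ∀ x ∈ Metric.closedBall w (δ / 12), ‖deriv g x - deriv g w‖ ≤ a / 2 := by
    intro x hx
    rw [Metric.mem_closedBall] at hx
    have h1 := Complex.dist_le_div_mul_dist_of_mapsTo_ball (f := deriv g) (c := w) (R₁ := δ / 2)
      (R₂ := 3 * a) (z := x) (hdg.mono (hsub.trans hb)) (fun y hy => by
        rw [Metric.mem_closedBall, dist_eq_norm]
        linarith [norm_sub_le (deriv g y) (deriv g w), hbd y hy])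
      (by rw [Metric.mem_ball]; linarith)
    rw [dist_eq_norm] at h1
    refine h1.trans ?_
    calc 3 * a / (δ / 2) * dist x w ≤ 3 * a / (δ / 2) * (δ / 12) := by gcongr
      _ = a / 2 := by field_simp; ring
  have hsub' : Metric.closedBall w (δ / 12) ⊆ Metric.ball w (δ / 2) :=
    Metric.closedBall_subset_ball (by linarith)
  have hdiff : ∀ x ∈ Metric.closedBall w (δ / 12), DifferentiableAt ℂ g x := fun x hx =>
    hg.differentiableAt (hU.mem_nhds (hb (hsub (hsub' hx))))
  have hlow : ∀ x ∈ Metric.closedBall w (δ / 12), a / 2 * ‖x - w‖ ≤ ‖g x - g w‖ := by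
    intro x hx
    have h1 := norm_sub_sub_mul_le (convex_closedBall w (δ / 12)) hdiff hsch hx
      (Metric.mem_closedBall_self (by positivity))
    have h2 := norm_le_insert (g x - g w) (deriv g w * (x - w))
    rw [norm_mul, ← ha] at h2
    linarith
  refine ⟨w, hw, ?_⟩
  have hDC : DiffContOnCl ℂ g (Metric.ball w (δ / 12)) :=
    (DifferentiableOn.mono (fun x hx => (hdiff x hx).differentiableWithinAt)
      (closure_ball w (by positivity)).subset).diffContOnCl
  -- On the circle of radius δ/12 one has |g - g(w)| ≥ aδ/24, so a ball of half that radius, aδ/48 ≥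
  -- h|g'(z)|/48, is covered.
  have h1 := hDC.ball_subset_image_closedBall (ε := a * δ / 24) (by positivity) (fun x hx => by
    have h2 := hlow x (Metric.sphere_subset_closedBall hx)
    rw [mem_sphere_iff_norm] at hx
    rw [hx] at h2
    linarith) (by
      have h3 : ∀ᶠ x in 𝓝[≠] w, g x ≠ g w := by
        filter_upwards [self_mem_nhdsWithin, mem_nhdsWithin_of_mem_nhds
          (Metric.closedBall_mem_nhds w (show 0 < δ / 12 by positivity))] with x hx hx'
        intro heq
        have h4 := hlow x hx'
        rw [heq, sub_self, norm_zero] at h4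
        have h5 : 0 < ‖x - w‖ := norm_pos_iff.2 (sub_ne_zero.2 hx)
        nlinarith
      exact h3.frequently.filter_mono nhdsWithin_le_nhds)
  refine (Metric.ball_subset_ball ?_).trans (h1.trans (Set.image_mono ?_))
  · linarith
  · exact hsub'.trans hsub

/-- A form of the three circles theorem: a holomorphic function on an annulus is controlled by a
power of the modulus with integer exponent. -/
theorem norm_le_of_annulus {g : ℂ → ℂ} {c : ℂ} {h r A M : ℝ} (hh : 0 < h) (n : ℕ)
    (hg : ∀ z ∈ Metric.closedBall c r, DifferentiableAt ℂ g z)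
    (hA : ∀ z ∈ Metric.sphere c h, ‖g z‖ ≤ A) (hM : ∀ z ∈ Metric.sphere c r, ‖g z‖ ≤ M) {z : ℂ}
    (hz : h ≤ dist z c) (hz' : dist z c ≤ r) :
    ‖g z‖ ≤ dist z c ^ n * max (A / h ^ n) (M / r ^ n) := by
  rcases hz.eq_or_lt with heq | hlt
  · rw [← heq]
    calc ‖g z‖ ≤ A := hA z heq.symm
      _ = h ^ n * (A / h ^ n) := by field_simp
      _ ≤ _ := by gcongr; exact le_max_left _ _
  rcases hz'.eq_or_lt with heq | hlt'
  · have hr : 0 < r := by linarith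
    rw [heq]
    calc ‖g z‖ ≤ M := hM z heq
      _ = r ^ n * (M / r ^ n) := by field_simp
      _ ≤ _ := by gcongr; exact le_max_right _ _
  set U : Set ℂ := {z | h < dist z c ∧ dist z c < r} with hU
  have hUo : IsOpen U := (isOpen_lt continuous_const (continuous_id.dist continuous_const)).inter
    (isOpen_lt (continuous_id.dist continuous_const) continuous_const)
  have hcl : closure U ⊆ {z | h ≤ dist z c ∧ dist z c ≤ r} := by
    refine closure_minimal (fun z hz => ⟨hz.1.le, hz.2.le⟩) ?_
    exact (isClosed_le continuous_const (continuous_id.dist continuous_const)).inter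
      (isClosed_le (continuous_id.dist continuous_const) continuous_const)
  have hne : ∀ z ∈ closure U, z - c ≠ 0 := fun z hz h0 => by
    have := (hcl hz).1
    rw [dist_eq_norm, h0, norm_zero] at this
    linarith
  -- Dividing by (z - c)^n reduces the claim to the maximum principle on the annulus.
  have hd : DiffContOnCl ℂ (fun z => g z / (z - c) ^ n) U := by
    refine DifferentiableOn.diffContOnCl fun z hz => ?_
    have h1 : DifferentiableAt ℂ (fun z => (z - c) ^ n) z := by fun_prop
    exact ((hg z (hcl hz).2).fun_div h1
      (pow_ne_zero n (hne z hz))).differentiableWithinAt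
  have key := Complex.norm_le_of_forall_mem_frontier_norm_le (U := U)
    (Metric.isBounded_ball.subset fun z hz => Metric.mem_ball.2 hz.2) hd
    (C := max (A / h ^ n) (M / r ^ n)) (fun z hz => by
      have hzc := hcl (frontier_subset_closure hz)
      have hzU : z ∉ U := by rw [hUo.frontier_eq] at hz; exact hz.2
      rw [norm_div, norm_pow, ← dist_eq_norm]
      rcases hzc.1.eq_or_lt with h1 | h1
      · rw [← h1]
        refine le_max_of_le_left ?_
        gcongr
        exact hA z h1.symm
      · have h2 : dist z c = r := le_antisymm hzc.2 (not_lt.1 fun h2 => hzU ⟨h1, h2⟩)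
        rw [h2]
        refine le_max_of_le_right ?_
        have : 0 < r := by linarith
        gcongr
        exact hM z h2) (subset_closure (show z ∈ U from ⟨hlt, hlt'⟩))
  have hpos : 0 < dist z c := hh.trans hlt
  rw [norm_div, norm_pow, ← dist_eq_norm, div_le_iff₀ (by positivity)] at key
  linarith

/-- Near a point where the derivative of `g` is not too small there is a disc on which `g` has
small distortion and whose image has a prescribed size. -/
theorem exists_disc_small_distortion {g : ℂ → ℂ} {U : Set ℂ} (hU : IsOpen U)
    (hg : DifferentiableOn ℂ g U) {c : ℂ} {r M η σ : ℝ} (hr : 0 < r)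
    (hb : Metric.closedBall c r ⊆ U) (hM : ∀ z ∈ Metric.closedBall c r, r * ‖deriv g z‖ ≤ M)
    (hη : 0 < η) (hηc : η ≤ r * ‖deriv g c‖) (hσ : 0 < σ) (hση : 8 * σ ≤ η) {n : ℕ}
    (hn : (2 * σ / η) ^ n * M ≤ η) : ∃ z κ, 0 < κ ∧
      (∀ x ∈ Metric.closedBall z κ, dist x c ≤ r / 4 ∧ ‖g x - g c‖ ≤ 2 * σ ∧
        ‖deriv g x - deriv g z‖ ≤ ‖deriv g z‖ / 10) ∧
      σ / (40 * 4 ^ n) ≤ κ * ‖deriv g z‖ := by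
  have hdg : DifferentiableOn ℂ (deriv g) U := hg.deriv hU
  have hsubr : ∀ j : ℕ, Metric.closedBall c (r / 2 ^ j) ⊆ Metric.closedBall c r := fun j =>
    Metric.closedBall_subset_closedBall (div_le_self hr.le (one_le_pow₀ one_le_two))
  have hex : ∀ j : ℕ, ∃ w ∈ Metric.closedBall c (r / 2 ^ j),
      ∀ x ∈ Metric.closedBall c (r / 2 ^ j), ‖deriv g x‖ ≤ ‖deriv g w‖ := fun j =>
    (isCompact_closedBall c (r / 2 ^ j)).exists_isMaxOn
      ⟨c, Metric.mem_closedBall_self (by positivity)⟩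
      (hdg.continuousOn.mono ((hsubr j).trans hb)).norm
  choose m hm hmax using hex
  set a : ℕ → ℝ := fun j => r * ‖deriv g (m j)‖ with ha
  have haη : ∀ j, η ≤ a j := fun j => hηc.trans
    (mul_le_mul_of_nonneg_left (hmax j c (Metric.mem_closedBall_self (by positivity))) hr.le)
  have haM : ∀ j, a j ≤ M := fun j => hM _ (hsubr j (hm j))
  have hM0 : 0 < M := hη.trans_le ((haη 0).trans (haM 0))
  -- Stopping scale: the first j for which radius times maximal derivative drops to σ. It is not 0,
  -- since a 0 ≥ η ≥ 8σ, so the previous scale k still exceeds σ.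
  have hP : ∃ j : ℕ, a j / 2 ^ j ≤ σ := by
    obtain ⟨j, hj⟩ := pow_unbounded_of_one_lt (M / σ) one_lt_two
    refine ⟨j, ?_⟩
    rw [div_lt_iff₀ hσ] at hj
    rw [div_le_iff₀ (by positivity)]
    linarith [haM j]
  classical
  obtain ⟨k, hk⟩ : ∃ k, Nat.find hP = k + 1 := by
    refine Nat.exists_eq_succ_of_ne_zero fun h0 => ?_
    have := Nat.find_spec hP
    rw [h0, pow_zero, div_one] at this
    linarith [haη 0]
  have hPk : a (k + 1) / 2 ^ (k + 1) ≤ σ := hk ▸ Nat.find_spec hP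
  have hPk' : σ < a k / 2 ^ k := not_le.1 (Nat.find_min hP (m := k) (by omega))
  set h : ℝ := 1 / 2 ^ (k + 1) with hh
  have hh0 : 0 < h := by positivity
  have hrh : r / 2 ^ (k + 1) = r * h := by rw [hh]; ring
  have hrh' : r / 2 ^ k = r * (2 * h) := by rw [hh, pow_succ]; field_simp
  have hah : h * a (k + 1) ≤ σ := by rw [hh]; linarith [hPk, div_eq_mul_one_div (a (k+1)) (2^(k+1))]
  have hah' : σ < 2 * h * a k := by
    have : a k / 2 ^ k = 2 * h * a k := by rw [hh, pow_succ]; field_simp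
    linarith
  have hhη : h * η ≤ σ := (mul_le_mul_of_nonneg_left (haη (k + 1)) hh0.le).trans hah
  have h8 : 8 * h ≤ 1 := by nlinarith
  have h2h : 2 * h ≤ 2 * σ / η := by rw [le_div_iff₀ hη]; linarith
  set z := m (k + 1) with hz
  -- Doubling the radius costs at most 2^n. In the annulus estimate the outer term is (2h)^n M ≤
  -- (2σ/η)^n M ≤ η ≤ a (k + 1), by the choice of n.
  have hgrow : a k ≤ 2 ^ n * a (k + 1) := by
    have h2n : (1 : ℝ) ≤ 2 ^ n := one_le_pow₀ one_le_two
    have ha1 : 0 < a (k + 1) := hη.trans_le (haη _)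
    rcases le_total (dist (m k) c) (r * h) with hle | hle
    · have := hmax (k + 1) (m k) (by rw [hrh]; exact hle)
      have h3 : a k ≤ a (k + 1) := mul_le_mul_of_nonneg_left this hr.le
      nlinarith
    · have hmk : dist (m k) c ≤ r * (2 * h) := by rw [← hrh']; exact hm k
      have h3 := norm_le_of_annulus (g := deriv g) (c := c) (h := r * h) (r := r)
        (A := ‖deriv g z‖) (M := M / r) (by positivity) n
        (fun x hx => hdg.differentiableAt (hU.mem_nhds (hb hx)))
        (fun x hx => hmax (k + 1) x (by rw [hrh]; exact Metric.sphere_subset_closedBall hx))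
        (fun x hx => by
          rw [le_div_iff₀ hr]; linarith [hM x (Metric.sphere_subset_closedBall hx)]) hle
        (hmk.trans (by nlinarith))
      have h4 : dist (m k) c ^ n * max (‖deriv g z‖ / (r * h) ^ n) (M / r / r ^ n) ≤
          2 ^ n * a (k + 1) / r := by
        rw [mul_max_of_nonneg _ _ (by positivity)]
        refine max_le ?_ ?_
        · calc dist (m k) c ^ n * (‖deriv g z‖ / (r * h) ^ n)
              ≤ (r * (2 * h)) ^ n * (‖deriv g z‖ / (r * h) ^ n) := by gcongr
            _ = 2 ^ n * a (k + 1) / r := by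
              rw [ha]; simp only [mul_pow, ← hz]; field_simp
        · calc dist (m k) c ^ n * (M / r / r ^ n)
              ≤ (r * (2 * h)) ^ n * (M / r / r ^ n) := by gcongr
            _ = (2 * h) ^ n * M / r := by rw [mul_pow r]; field_simp
            _ ≤ (2 * σ / η) ^ n * M / r := by gcongr
            _ ≤ η / r := by gcongr
            _ ≤ a (k + 1) / r := by gcongr; exact haη _
            _ ≤ 2 ^ n * a (k + 1) / r := by gcongr; nlinarith
      have h5 := h3.trans h4
      rw [le_div_iff₀ hr] at h5
      simp only [ha] at h5 ⊢
      linarith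
  have hd0 : 0 < ‖deriv g z‖ := by
    have := hη.trans_le (haη (k + 1))
    exact pos_of_mul_pos_right this hr.le
  have hzc : dist z c ≤ r * h := by rw [← hrh]; exact hm (k + 1)
  have hsub2 : Metric.ball z (r * h) ⊆ Metric.closedBall c (r / 2 ^ k) := by
    intro x hx
    rw [Metric.mem_ball] at hx
    rw [Metric.mem_closedBall, hrh']
    linarith [dist_triangle x z c]
  have hbd : ∀ x ∈ Metric.ball z (r * h), ‖deriv g x‖ ≤ 2 ^ n * ‖deriv g z‖ := by
    intro x hx
    have h1 := hmax k x (hsub2 hx)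
    have h2 : r * ‖deriv g (m k)‖ ≤ r * (2 ^ n * ‖deriv g z‖) := by
      have := hgrow
      simp only [ha] at this
      linarith
    exact h1.trans (le_of_mul_le_mul_left h2 hr)
  -- Schwarz's lemma on the ball of radius rh, with |g' - g'(z)| ≤ 2 · 2^n |g'(z)|, gives relative
  -- distortion 1/10 at this radius.
  set κ : ℝ := r * h / (20 * 2 ^ n) with hκ
  have h2n : (1 : ℝ) ≤ 2 ^ n := one_le_pow₀ one_le_two
  have hκ0 : 0 < κ := by positivity
  have hκr : κ ≤ r * h / 20 := by
    rw [hκ]; gcongr; linarith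
  have hrh0 : 0 < r * h := by positivity
  have hdist : ∀ x ∈ Metric.closedBall z κ, ‖deriv g x - deriv g z‖ ≤ ‖deriv g z‖ / 10 := by
    intro x hx
    rw [Metric.mem_closedBall] at hx
    have h1 := Complex.dist_le_div_mul_dist_of_mapsTo_ball (f := deriv g) (c := z) (R₁ := r * h)
      (R₂ := 2 * 2 ^ n * ‖deriv g z‖) (z := x) (hdg.mono (hsub2.trans ((hsubr k).trans hb)))
      (fun y hy => by
        rw [Metric.mem_closedBall, dist_eq_norm]
        have := hbd y hy
        nlinarith [norm_sub_le (deriv g y) (deriv g z)])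
      (by rw [Metric.mem_ball]; linarith)
    rw [dist_eq_norm] at h1
    refine h1.trans ?_
    calc 2 * 2 ^ n * ‖deriv g z‖ / (r * h) * dist x z
        ≤ 2 * 2 ^ n * ‖deriv g z‖ / (r * h) * κ := by gcongr
      _ = ‖deriv g z‖ / 10 := by rw [hκ]; field_simp; ring
  have hsubκ : Metric.closedBall z κ ⊆ Metric.ball z (r * h) :=
    Metric.closedBall_subset_ball (by linarith)
  have hdiff : ∀ x ∈ Metric.closedBall c r, DifferentiableAt ℂ g x := fun x hx =>
    hg.differentiableAt (hU.mem_nhds (hb hx))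
  have hgz : ‖g z - g c‖ ≤ σ := by
    have h1 := (convex_closedBall c (r / 2 ^ (k + 1))).norm_image_sub_le_of_norm_deriv_le
      (f := g) (C := ‖deriv g z‖) (fun x hx => hdiff x (hsubr _ hx)) (hmax (k + 1))
      (Metric.mem_closedBall_self (by positivity)) (hm (k + 1))
    refine h1.trans ?_
    rw [← dist_eq_norm]
    calc ‖deriv g z‖ * dist z c ≤ ‖deriv g z‖ * (r * h) := by gcongr
      _ = h * a (k + 1) := by rw [ha]; ring
      _ ≤ σ := hah
  refine ⟨z, κ, hκ0, fun x hx => ⟨?_, ?_, hdist x hx⟩, ?_⟩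
  · have := Metric.mem_closedBall.1 hx
    nlinarith [dist_triangle x z c]
  · have h1 := (convex_closedBall z κ).norm_image_sub_le_of_norm_deriv_le
      (f := g) (C := 2 * ‖deriv g z‖) (fun x hx => hdiff x (hsubr _ (hsub2 (hsubκ hx))))
      (fun x hx => by
        have := hdist x hx
        have := norm_le_insert' (deriv g x) (deriv g z)
        linarith) (Metric.mem_closedBall_self hκ0.le) hx
    have h2 : ‖g x - g z‖ ≤ σ := by
      refine h1.trans ?_
      rw [← dist_eq_norm]
      calc 2 * ‖deriv g z‖ * dist x z ≤ 2 * ‖deriv g z‖ * (r * h / 20) := by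
            gcongr; exact (Metric.mem_closedBall.1 hx).trans hκr
        _ = h * a (k + 1) / 10 := by rw [ha]; ring
        _ ≤ σ := by linarith
    linarith [norm_sub_le_norm_sub_add_norm_sub (g x) (g z) (g c)]
  · have h1 : κ * ‖deriv g z‖ = h * a (k + 1) / (20 * 2 ^ n) := by rw [hκ, ha]; ring
    have h4 : (4 : ℝ) ^ n = 2 ^ n * 2 ^ n := by rw [← mul_pow]; norm_num
    rw [h1, h4, div_le_div_iff₀ (by positivity) (by positivity)]
    have h2 : σ ≤ 2 * h * (2 ^ n * a (k + 1)) :=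
      hah'.le.trans (mul_le_mul_of_nonneg_left hgrow (by positivity))
    nlinarith [mul_le_mul_of_nonneg_right h2 (show (0:ℝ) ≤ 20 * 2 ^ n by positivity)]

namespace LogInverse

variable {f G : ℂ → ℂ} {ℓ : ℝ}

/-- If the product exceeded 1344 = 7 · 4 · 48, the Bloch-type theorem on the disc of radius Re z / 4
would put a disc of radius 7 > 2π in the image of G. Far to the right such a disc contains a point
with |f(exp w)| ≤ `exp ℓ`, which the image omits. -/
theorem norm_deriv_mul_re_le (h : LogInverse f ℓ G)
    (hf : ¬ ∃ p : Polynomial ℂ, ∀ z, f z = p.eval z) :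
    ∃ T, ℓ < T ∧ ∀ z : ℂ, T ≤ z.re → ‖deriv G z‖ * z.re ≤ 1344 := by
  obtain ⟨x₀, hx₀⟩ := h.exists_norm_le_on_segment hf
  obtain ⟨T, hT, hTx⟩ := h.exists_lt_re x₀
  have hT0 : 0 < T := h.pos.trans hT
  refine ⟨2 * T, by linarith, fun z hz => ?_⟩
  by_contra hlt
  push Not at hlt
  have hre : ∀ w ∈ Metric.closedBall z (z.re / 4), T ≤ w.re := by
    intro w hw
    rw [Metric.mem_closedBall, dist_eq_norm] at hw
    have := (abs_le.1 (Complex.abs_re_le_norm (w - z))).1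
    rw [Complex.sub_re] at this
    linarith
  have hpos : 0 < z.re := by linarith
  obtain ⟨w, hw, hball⟩ := exists_ball_subset_image (isOpen_re_gt ℓ) h.differentiableOn
    (z := z) (h := z.re / 4) (by linarith) (fun w hw => hT.trans_le (hre w hw)) (by
      intro h0
      rw [h0, norm_zero, zero_mul] at hlt
      linarith)
  obtain ⟨y, hy, hle⟩ := hx₀ (G w) (hTx w (hre w hw)).le
  obtain ⟨w', hw', heq⟩ := hball (show G w + y * Complex.I ∈ _ by
    rw [Metric.mem_ball, dist_eq_norm, add_sub_cancel_left, norm_mul, Complex.norm_I, mul_one,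
      Complex.norm_real, Real.norm_of_nonneg hy.1]
    have := hy.2
    have := Real.pi_lt_d2
    linarith)
  rw [← heq] at hle
  exact absurd (h.lt_norm_map_exp (hT.trans_le (hre w' hw'))) (not_lt.2 hle)

theorem hasDerivAt_re_comp_exp (h : LogInverse f ℓ G) {s : ℝ} (hs : ℓ < Real.exp s) :
    HasDerivAt (fun s : ℝ => (G (Real.exp s)).re) (Real.exp s * deriv G (Real.exp s)).re s := by
  have h1 : HasDerivAt (fun s : ℝ => G (Real.exp s)) (deriv G (Real.exp s) * Real.exp s) s :=
    (h.differentiableAt (z := (Real.exp s : ℂ)) (by rwa [Complex.ofReal_re])).hasDerivAt.comp s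
      (Real.hasDerivAt_exp s).ofReal_comp
  have h2 := Complex.reCLM.hasFDerivAt.comp_hasDerivAt s h1
  rw [mul_comm]
  exact h2

/-- In the variable s = log t the derivative bound says that Re G is 1344-Lipschitz. -/
theorem re_le_log (h : LogInverse f ℓ G) {T : ℝ} (hT : ℓ < T)
    (hder : ∀ z : ℂ, T ≤ z.re → ‖deriv G z‖ * z.re ≤ 1344) :
    ∃ C, ∀ t : ℝ, T ≤ t → (G t).re ≤ 1344 * Real.log t + C := by
  have hT0 : 0 < T := h.pos.trans hT
  refine ⟨(G T).re - 1344 * Real.log T, fun t ht => ?_⟩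
  have ht0 : 0 < t := hT0.trans_le ht
  have hexp : ∀ s ∈ Set.Ici (Real.log T), T ≤ Real.exp s := fun s hs => by
    rw [← Real.exp_log hT0]; exact Real.exp_le_exp.2 hs
  have h1 := (convex_Ici (Real.log T)).norm_image_sub_le_of_norm_hasDerivWithin_le
    (f := fun s : ℝ => (G (Real.exp s)).re) (C := 1344)
    (fun s hs => (h.hasDerivAt_re_comp_exp (hT.trans_le (hexp s hs))).hasDerivWithinAt)
    (fun s hs => by
      rw [Real.norm_eq_abs]
      refine (Complex.abs_re_le_norm _).trans ?_
      have := hder (Real.exp s) (by rw [Complex.ofReal_re]; exact hexp s hs)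
      rw [Complex.ofReal_re] at this
      rw [norm_mul, Complex.norm_real, Real.norm_of_nonneg (Real.exp_pos s).le]
      linarith) (x := Real.log T) (y := Real.log t) (by simp) (Real.log_le_log hT0 ht)
  simp only [Real.exp_log hT0, Real.exp_log ht0, Real.norm_eq_abs] at h1
  rw [abs_of_nonneg (sub_nonneg.2 (Real.log_le_log hT0 ht))] at h1
  linarith [le_abs_self ((G t).re - (G T).re)]

end LogInverse

end EntireDynamics

/-! ### Cantor sets of graph-directed type and the mass distribution principle -/

namespace EntireDynamics

/-- A graph-directed system of maps between compact pieces of a metric space. -/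
structure PieceSystem (B ι X : Type*) [MetricSpace X] where
  piece : B → Set X
  index : B → Finset ι
  child : B → ι → B
  map : B → ι → X → X
  isCompact_piece : ∀ b, IsCompact (piece b)
  nonempty_piece : ∀ b, (piece b).Nonempty
  one_lt_card : ∀ b, 1 < (index b).card
  mapsTo : ∀ b, ∀ i ∈ index b, Set.MapsTo (map b i) (piece (child b i)) (piece b)
  continuousOn : ∀ b, ∀ i ∈ index b, ContinuousOn (map b i) (piece (child b i))

namespace PieceSystem

variable {B ι X : Type*} [MetricSpace X] (S : PieceSystem B ι X)

/-- The union of the pieces of generation `n` inside the piece of `b`. -/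
def level : ℕ → B → Set X
  | 0, b => S.piece b
  | n + 1, b => ⋃ i ∈ S.index b, S.map b i '' level n (S.child b i)

/-- The limit set of the system inside the piece of `b`. -/
def limitSet (b : B) : Set X := ⋂ n, S.level n b

theorem level_succ (n : ℕ) (b : B) :
    S.level (n + 1) b = ⋃ i ∈ S.index b, S.map b i '' S.level n (S.child b i) := rfl

theorem level_succ_subset (n : ℕ) (b : B) : S.level (n + 1) b ⊆ S.level n b := by
  induction n generalizing b with
  | zero =>
    rw [level_succ]
    exact Set.iUnion₂_subset fun i hi => (S.mapsTo b i hi).image_subset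
  | succ n ih =>
    rw [level_succ, level_succ]
    exact Set.iUnion₂_mono fun i _ => Set.image_mono (ih _)

theorem level_antitone (b : B) : Antitone fun n => S.level n b :=
  antitone_nat_of_succ_le fun n => S.level_succ_subset n b

theorem level_subset_piece (n : ℕ) (b : B) : S.level n b ⊆ S.piece b :=
  S.level_antitone b (Nat.zero_le n)

theorem isCompact_level (n : ℕ) (b : B) : IsCompact (S.level n b) := by
  induction n generalizing b with
  | zero => exact S.isCompact_piece b
  | succ n ih =>
    rw [level_succ]
    exact (S.index b).isCompact_biUnion fun i hi =>
      (ih _).image_of_continuousOn ((S.continuousOn b i hi).mono (S.level_subset_piece n _))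

theorem nonempty_level (n : ℕ) (b : B) : (S.level n b).Nonempty := by
  induction n generalizing b with
  | zero => exact S.nonempty_piece b
  | succ n ih =>
    obtain ⟨i, hi⟩ := Finset.card_pos.1 (zero_lt_one.trans (S.one_lt_card b))
    obtain ⟨x, hx⟩ := ih (S.child b i)
    exact ⟨_, Set.mem_biUnion hi ⟨x, hx, rfl⟩⟩

theorem isCompact_limitSet (b : B) : IsCompact (S.limitSet b) :=
  (S.isCompact_level 0 b).of_isClosed_subset
    (isClosed_iInter fun n => (S.isCompact_level n b).isClosed) (Set.iInter_subset _ 0)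

theorem nonempty_limitSet (b : B) : (S.limitSet b).Nonempty :=
  IsCompact.nonempty_iInter_of_sequence_nonempty_isCompact_isClosed _
    (fun n => S.level_succ_subset n b) (fun n => S.nonempty_level n b) (S.isCompact_level 0 b)
    fun n => (S.isCompact_level n b).isClosed

theorem limitSet_subset_piece (b : B) : S.limitSet b ⊆ S.piece b := Set.iInter_subset _ 0

theorem map_mem_limitSet {b : B} {i : ι} (hi : i ∈ S.index b) {x : X}
    (hx : x ∈ S.limitSet (S.child b i)) : S.map b i x ∈ S.limitSet b := by
  refine Set.mem_iInter.2 fun n => ?_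
  cases n with
  | zero => exact S.mapsTo b i hi (S.limitSet_subset_piece _ hx)
  | succ n => exact Set.mem_biUnion hi ⟨x, Set.mem_iInter.1 hx n, rfl⟩

open Classical in
/-- The indices of the pieces of the first generation that meet `U`. -/
noncomputable def touched (b : B) (U : Set X) : Finset ι :=
  (S.index b).filter fun i => (U ∩ S.map b i '' S.piece (S.child b i)).Nonempty

/-- The mass distribution principle for piece systems, in terms of finite covers. -/
theorem le_sum_diam_rpow_of_cover {s : ℝ} (hs : 0 ≤ s) {v : B → ℝ} (hv : ∀ b, 0 < v b)
    {l : B → ι → ℝ} (hl : ∀ b, ∀ i ∈ S.index b, 0 < l b i)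
    (hmap : ∀ b, ∀ i ∈ S.index b, ∀ x ∈ S.piece (S.child b i), ∀ y ∈ S.piece (S.child b i),
      l b i * dist x y ≤ dist (S.map b i x) (S.map b i y))
    (hchild : ∀ b, ∀ i ∈ S.index b,
      v b / (S.index b).card ≤ l b i ^ s * v (S.child b i))
    (hbig : ∀ b, ∀ U : Set X, Bornology.IsBounded U → 1 < (S.touched b U).card →
      v b * (S.touched b U).card / (S.index b).card ≤ Metric.diam U ^ s)
    (n : ℕ) : ∀ (F : Finset ℕ), F.card = n → ∀ (U : ℕ → Set X) (b : B),
      (∀ j ∈ F, Bornology.IsBounded (U j)) → S.limitSet b ⊆ ⋃ j ∈ F, U j →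
      v b ≤ ∑ j ∈ F, Metric.diam (U j) ^ s := by
  classical
  induction n using Nat.strong_induction_on with
  | _ n ih =>
  intro F hF U b hU hcov
  -- Induction on the number of covering sets. Sets meeting at least two children pay for all the
  -- children they touch, by the separation hypothesis. The remaining children W are covered by sets
  -- meeting no other child, so their families `Fi i` are disjoint and the induction hypothesis
  -- applies to their preimages.
  set big := F.filter fun j => 1 < (S.touched b (U j)).card with hbigdef
  set W := (S.index b).filter fun i => ∀ j ∈ big, i ∉ S.touched b (U j) with hW
  set Fi : ι → Finset ℕ := fun i => F.filter fun j => i ∈ S.touched b (U j) with hFi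
  have hcovi : ∀ i ∈ S.index b, S.limitSet (S.child b i) ⊆
      ⋃ j ∈ Fi i, S.piece (S.child b i) ∩ S.map b i ⁻¹' U j := by
    intro i hi x hx
    have hxQ := S.limitSet_subset_piece _ hx
    obtain ⟨j, hj, hxj⟩ := Set.mem_iUnion₂.1 (hcov (S.map_mem_limitSet hi hx))
    refine Set.mem_iUnion₂.2 ⟨j, Finset.mem_filter.2 ⟨hj, ?_⟩, hxQ, hxj⟩
    exact Finset.mem_filter.2 ⟨hi, _, hxj, x, hxQ, rfl⟩
  have hFne : ∀ i ∈ S.index b, (Fi i).Nonempty := by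
    intro i hi
    obtain ⟨x, hx⟩ := S.nonempty_limitSet (S.child b i)
    obtain ⟨j, hj, -⟩ := Set.mem_iUnion₂.1 (hcovi i hi hx)
    exact ⟨j, hj⟩
  have hFsub : ∀ i, Fi i ⊆ F := fun i => Finset.filter_subset _ _
  have hnotbig : ∀ i ∈ W, ∀ j ∈ Fi i, j ∉ big := fun i hi j hj hjb =>
    (Finset.mem_filter.1 hi).2 j hjb (Finset.mem_filter.1 hj).2
  have hdisj : ∀ i ∈ W, ∀ i' ∈ W, i ≠ i' → Disjoint (Fi i) (Fi i') := by
    intro i hi i' hi' hne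
    rw [Finset.disjoint_left]
    intro j hj hj'
    refine hnotbig i hi j hj (Finset.mem_filter.2 ⟨hFsub i hj, ?_⟩)
    exact Finset.one_lt_card.2 ⟨i, (Finset.mem_filter.1 hj).2, i', (Finset.mem_filter.1 hj').2,
      hne⟩
  -- The family is strictly smaller: it omits any big set, and if there is none, it omits the sets
  -- needed to cover a second child.
  have hlt : ∀ i ∈ W, (Fi i).card < n := by
    intro i hi
    rw [← hF]
    refine Finset.card_lt_card ((Finset.ssubset_iff_of_subset (hFsub i)).2 ?_)
    rcases big.eq_empty_or_nonempty with h0 | ⟨j, hj⟩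
    · obtain ⟨i', hi', hne⟩ := Finset.exists_mem_ne (S.one_lt_card b) i
      obtain ⟨j, hj⟩ := hFne i' hi'
      have hi'W : i' ∈ W := Finset.mem_filter.2 ⟨hi', by simp [h0]⟩
      exact ⟨j, hFsub i' hj, Finset.disjoint_left.1 (hdisj i' hi'W i hi hne) hj⟩
    · exact ⟨j, (Finset.mem_filter.1 hj).1, fun hj' => hnotbig i hi j hj' hj⟩
  have hN : (0 : ℝ) < (S.index b).card := by
    exact_mod_cast zero_lt_one.trans (S.one_lt_card b)
  have hchildsum : ∀ i ∈ W, v b / (S.index b).card ≤ ∑ j ∈ Fi i, Metric.diam (U j) ^ s := by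
    intro i hi
    have hiI : i ∈ S.index b := (Finset.mem_filter.1 hi).1
    have hl0 := hl b i hiI
    have h1 := ih _ (hlt i hi) (Fi i) rfl
      (fun j => S.piece (S.child b i) ∩ S.map b i ⁻¹' U j) (S.child b i)
      (fun j _ => (S.isCompact_piece _).isBounded.subset Set.inter_subset_left) (hcovi i hiI)
    have h2 : ∀ j ∈ Fi i, l b i ^ s *
        Metric.diam (S.piece (S.child b i) ∩ S.map b i ⁻¹' U j) ^ s ≤ Metric.diam (U j) ^ s := by
      intro j hj
      rw [← Real.mul_rpow hl0.le Metric.diam_nonneg]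
      refine Real.rpow_le_rpow (mul_nonneg hl0.le Metric.diam_nonneg) ?_ hs
      rw [mul_comm, ← le_div_iff₀ hl0]
      refine Metric.diam_le_of_forall_dist_le (div_nonneg Metric.diam_nonneg hl0.le) ?_
      rintro x ⟨hx, hxU⟩ y ⟨hy, hyU⟩
      rw [le_div_iff₀ hl0, mul_comm]
      exact (hmap b i hiI x hx y hy).trans
        (Metric.dist_le_diam_of_mem (hU j (hFsub i hj)) hxU hyU)
    refine (hchild b i hiI).trans ((mul_le_mul_of_nonneg_left h1 (by positivity)).trans ?_)
    rw [Finset.mul_sum]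
    exact Finset.sum_le_sum h2
  have hbigsum : ∀ j ∈ big, v b / (S.index b).card * (S.touched b (U j)).card ≤
      Metric.diam (U j) ^ s := by
    intro j hj
    have hj' := Finset.mem_filter.1 hj
    have := hbig b (U j) (hU j hj'.1) hj'.2
    rwa [mul_div_right_comm] at this
  have hcard : (S.index b).card ≤ ∑ j ∈ big, (S.touched b (U j)).card + W.card := by
    have hsub : S.index b ⊆ (big.biUnion fun j => S.touched b (U j)) ∪ W := by
      intro i hi
      rw [Finset.mem_union]
      by_cases h : ∀ j ∈ big, i ∉ S.touched b (U j)
      · exact Or.inr (Finset.mem_filter.2 ⟨hi, h⟩)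
      · push Not at h
        obtain ⟨j, hj, hij⟩ := h
        exact Or.inl (Finset.mem_biUnion.2 ⟨j, hj, hij⟩)
    exact (Finset.card_le_card hsub).trans ((Finset.card_union_le _ _).trans
      (Nat.add_le_add_right Finset.card_biUnion_le _))
  have hcard' : ((S.index b).card : ℝ) ≤
      ∑ j ∈ big, ((S.touched b (U j)).card : ℝ) + W.card := by exact_mod_cast hcard
  have hdisj' : Disjoint big (W.biUnion Fi) := by
    rw [Finset.disjoint_left]
    intro j hj hj'
    obtain ⟨i, hi, hij⟩ := Finset.mem_biUnion.1 hj'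
    exact hnotbig i hi j hij hj
  calc v b = v b / (S.index b).card * (S.index b).card := by field_simp
    _ ≤ v b / (S.index b).card *
        (∑ j ∈ big, ((S.touched b (U j)).card : ℝ) + W.card) :=
      mul_le_mul_of_nonneg_left hcard' (div_nonneg (hv b).le hN.le)
    _ = ∑ j ∈ big, v b / (S.index b).card * (S.touched b (U j)).card +
        ∑ i ∈ W, v b / (S.index b).card := by
      rw [mul_add, Finset.mul_sum, Finset.sum_const, nsmul_eq_mul]; ring
    _ ≤ ∑ j ∈ big, Metric.diam (U j) ^ s + ∑ i ∈ W, ∑ j ∈ Fi i, Metric.diam (U j) ^ s :=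
      add_le_add (Finset.sum_le_sum hbigsum) (Finset.sum_le_sum hchildsum)
    _ = ∑ j ∈ big ∪ W.biUnion Fi, Metric.diam (U j) ^ s := by
      rw [Finset.sum_union hdisj', Finset.sum_biUnion fun i hi i' hi' hne => hdisj i hi i' hi' hne]
    _ ≤ ∑ j ∈ F, Metric.diam (U j) ^ s := by
      refine Finset.sum_le_sum_of_subset_of_nonneg ?_ fun j _ _ =>
        Real.rpow_nonneg Metric.diam_nonneg s
      exact Finset.union_subset (Finset.filter_subset _ _)
        (Finset.biUnion_subset.2 fun i _ => hFsub i)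

end PieceSystem

/-- A compact set whose finite covers have `s`-dimensional size bounded below has Hausdorff
dimension at least `s`. -/
theorem le_dimH_of_forall_finite_cover {X : Type*} [MetricSpace X] {K : Set X} (hK : IsCompact K)
    {s v : ℝ} (hs : 0 < s) (hv : 0 < v)
    (h : ∀ (F : Finset ℕ) (U : ℕ → Set X), (∀ j ∈ F, Bornology.IsBounded (U j)) →
      K ⊆ ⋃ j ∈ F, U j → v ≤ ∑ j ∈ F, Metric.diam (U j) ^ s) :
    ENNReal.ofReal s ≤ dimH K := by
  borelize X
  by_contra hlt
  rw [not_le] at hlt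
  have h0 : MeasureTheory.Measure.hausdorffMeasure s K = 0 := by
    have := hausdorffMeasure_of_dimH_lt (d := s.toNNReal) hlt
    rwa [Real.coe_toNNReal s hs.le] at this
  rw [MeasureTheory.Measure.hausdorffMeasure_apply] at h0
  have h1 : (⨅ (t : ℕ → Set X) (_ : K ⊆ ⋃ n, t n) (_ : ∀ n, Metric.ediam (t n) ≤ 1),
      ∑' n, ⨆ _ : (t n).Nonempty, Metric.ediam (t n) ^ s) < ENNReal.ofReal (v / 2) := by
    refine lt_of_le_of_lt ?_ (ENNReal.ofReal_pos.2 (half_pos hv))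
    rw [← h0]
    exact le_iSup₂_of_le (1 : ENNReal) one_pos le_rfl
  simp only [iInf_lt_iff] at h1
  obtain ⟨t, hcov, hdiam, hsum⟩ := h1
  -- Thickening the sets makes the cover open at a total cost of at most v/2. The original sum is
  -- below v/2, so the finite subcover contradicts the lower bound v.
  have hδ : ∀ n, ∃ δ > 0, (Metric.diam (t n) + 2 * δ) ^ s ≤
      Metric.diam (t n) ^ s + v / 2 / 2 / 2 ^ n := by
    intro n
    have hc : ContinuousAt (fun δ : ℝ => (Metric.diam (t n) + 2 * δ) ^ s) 0 :=
      ContinuousAt.rpow_const (by fun_prop) (Or.inr hs.le)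
    have hev := hc.eventually (gt_mem_nhds
      (show (Metric.diam (t n) + 2 * 0) ^ s < Metric.diam (t n) ^ s + v / 2 / 2 / 2 ^ n by
        rw [mul_zero, add_zero]; linarith [show 0 < v / 2 / 2 / 2 ^ n by positivity]))
    obtain ⟨ε, hε, hball⟩ := Metric.eventually_nhds_iff.1 hev
    refine ⟨ε / 2, by positivity, (hball ?_).le⟩
    rw [Real.dist_eq, sub_zero, abs_of_pos (by positivity)]
    linarith
  choose δ hδ0 hδ using hδ
  obtain ⟨F, hF⟩ := hK.elim_finite_subcover (fun n => Metric.thickening (δ n) (t n))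
    (fun n => Metric.isOpen_thickening)
    (hcov.trans (Set.iUnion_mono fun n => Metric.self_subset_thickening (hδ0 n) _))
  have hbdd : ∀ n, Bornology.IsBounded (t n) := fun n =>
    Metric.isBounded_iff_ediam_ne_top.2 (ne_top_of_le_ne_top ENNReal.one_ne_top (hdiam n))
  have key := h F _ (fun j _ => (hbdd j).thickening) hF
  have hsum' : ∑ j ∈ F, Metric.diam (t j) ^ s < v / 2 := by
    have h2 : ∑ j ∈ F, ENNReal.ofReal (Metric.diam (t j) ^ s) < ENNReal.ofReal (v / 2) := by
      refine lt_of_le_of_lt (le_trans (Finset.sum_le_sum fun j _ => ?_)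
        (ENNReal.sum_le_tsum F)) hsum
      rcases (t j).eq_empty_or_nonempty with h3 | h3
      · simp [h3, Real.zero_rpow hs.ne']
      · rw [ciSup_pos h3, ← ENNReal.ofReal_rpow_of_nonneg Metric.diam_nonneg hs.le]
        gcongr
        rw [Metric.diam, ENNReal.ofReal_toReal
          (ne_top_of_le_ne_top ENNReal.one_ne_top (hdiam j))]
    rw [← ENNReal.ofReal_sum_of_nonneg fun j _ => Real.rpow_nonneg Metric.diam_nonneg s] at h2
    exact (ENNReal.ofReal_lt_ofReal_iff (half_pos hv)).1 h2
  have hterm : ∀ j ∈ F, Metric.diam (Metric.thickening (δ j) (t j)) ^ s ≤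
      Metric.diam (t j) ^ s + v / 2 / 2 / 2 ^ j := fun j _ =>
    (Real.rpow_le_rpow Metric.diam_nonneg (Metric.diam_thickening_le _ (hδ0 j).le) hs.le).trans
      (hδ j)
  have hgeo : ∑ j ∈ F, v / 2 / 2 / 2 ^ j ≤ v / 2 :=
    (summable_geometric_two' (v / 2)).sum_le_tsum F (fun j _ => by positivity) |>.trans_eq
      (tsum_geometric_two' (v / 2))
  have := Finset.sum_le_sum hterm
  rw [Finset.sum_add_distrib] at this
  linarith

end EntireDynamics

/-! ### Counting estimates -/

namespace EntireDynamics

theorem card_le_of_sub_le {S : Finset ℤ} {D : ℝ} (hD : 0 ≤ D)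
    (h : ∀ x ∈ S, ∀ y ∈ S, (x : ℝ) - y ≤ D) : (S.card : ℝ) ≤ D + 1 := by
  rcases S.eq_empty_or_nonempty with rfl | hS
  · simp; linarith
  have hsub : S ⊆ Finset.Icc (S.min' hS) (S.max' hS) := fun x hx =>
    Finset.mem_Icc.2 ⟨S.min'_le x hx, S.le_max' x hx⟩
  have h1 := Finset.card_le_card hsub
  rw [Int.card_Icc] at h1
  have h2 := h _ (S.max'_mem hS) _ (S.min'_mem hS)
  have h3 : S.min' hS ≤ S.max' hS := S.min'_le _ (S.max'_mem hS)
  have h4 : (S.card : ℤ) ≤ S.max' hS + 1 - S.min' hS := by omega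
  have h5 : (S.card : ℝ) ≤ S.max' hS + 1 - S.min' hS := by exact_mod_cast h4
  linarith

/-- Points close to a lattice with spacings `2 * σ` and `2 * π`, in number and mutual distance. -/
theorem card_le_of_close_to_lattice {I : Finset (ℤ × ℤ)} {σ δ a : ℝ} {y : ℤ → ℝ} {u : ℤ × ℤ → ℂ}
    (hσ : 0 < σ) (hσ1 : σ ≤ 1) (hre : ∀ i ∈ I, |(u i).re - (a + 2 * i.1 * σ)| ≤ 3 * σ / 4)
    (him : ∀ i ∈ I, |(u i).im - (y i.1 + 2 * Real.pi * i.2)| ≤ 1 / 4)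
    (hdist : ∀ i ∈ I, ∀ i' ∈ I, ‖u i - u i'‖ ≤ δ) (hI : 1 < I.card) :
    σ / 2 ≤ δ ∧ (I.card : ℝ) ≤ 5 * δ * max 1 δ / σ := by
  classical
  have hre' : ∀ i ∈ I, ∀ i' ∈ I, 2 * σ * ((i.1 : ℝ) - i'.1) ≤ δ + 3 * σ / 2 := by
    intro i hi i' hi'
    have h1 := (Complex.re_le_norm (u i - u i')).trans (hdist i hi i' hi')
    rw [Complex.sub_re] at h1
    have h2 := abs_le.1 (hre i hi)
    have h3 := abs_le.1 (hre i' hi')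
    linarith
  have him' : ∀ i ∈ I, ∀ i' ∈ I, i.1 = i'.1 → 2 * Real.pi * ((i.2 : ℝ) - i'.2) ≤ δ + 1 / 2 := by
    intro i hi i' hi' heq
    have h1 := (Complex.im_le_norm (u i - u i')).trans (hdist i hi i' hi')
    rw [Complex.sub_im] at h1
    have h2 := abs_le.1 (him i hi)
    have h3 := abs_le.1 (him i' hi')
    rw [heq] at h2
    linarith
  have hpi := Real.pi_gt_three
  -- Different columns are at least 2σ - 2 · (3σ/4) = σ/2 apart, and different points of one column
  -- at least 2π - 1/2.
  have hlow : σ / 2 ≤ δ := by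
    obtain ⟨i, hi, i', hi', hne⟩ := Finset.one_lt_card.1 hI
    have key : ∀ i ∈ I, ∀ i' ∈ I, i'.1 < i.1 → σ / 2 ≤ δ := by
      intro i hi i' hi' hlt
      have h1 := hre' i hi i' hi'
      have h2 : (1 : ℝ) ≤ (i.1 : ℝ) - i'.1 := by
        have : (1 : ℤ) ≤ i.1 - i'.1 := by omega
        exact_mod_cast this
      nlinarith
    have key' : ∀ i ∈ I, ∀ i' ∈ I, i.1 = i'.1 → i'.2 < i.2 → σ / 2 ≤ δ := by
      intro i hi i' hi' heq hlt
      have h1 := him' i hi i' hi' heq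
      have h2 : (1 : ℝ) ≤ (i.2 : ℝ) - i'.2 := by
        have : (1 : ℤ) ≤ i.2 - i'.2 := by omega
        exact_mod_cast this
      nlinarith
    rcases lt_trichotomy i.1 i'.1 with h | h | h
    · exact key i' hi' i hi h
    · rcases lt_trichotomy i.2 i'.2 with h' | h' | h'
      · exact key' i' hi' i hi h.symm h'
      · exact absurd (Prod.ext h h') hne
      · exact key' i hi i' hi' h h'
    · exact key i hi i' hi' h
  have hδ : 0 < δ := by linarith
  refine ⟨hlow, ?_⟩
  have hfst : ((I.image Prod.fst).card : ℝ) ≤ (δ + 3 * σ / 2) / (2 * σ) + 1 := by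
    refine card_le_of_sub_le (by positivity) fun x hx x' hx' => ?_
    obtain ⟨i, hi, rfl⟩ := Finset.mem_image.1 hx
    obtain ⟨i', hi', rfl⟩ := Finset.mem_image.1 hx'
    rw [le_div_iff₀ (by positivity), mul_comm]
    exact hre' i hi i' hi'
  have hsnd : ∀ j, ((I.filter fun i => i.1 = j).card : ℝ) ≤ (δ + 1 / 2) / 6 + 1 := by
    intro j
    have hinj : Set.InjOn Prod.snd (I.filter fun i => i.1 = j : Set (ℤ × ℤ)) := by
      rintro i hi i' hi' heq
      have h1 := (Finset.mem_filter.1 (Finset.mem_coe.1 hi)).2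
      have h2 := (Finset.mem_filter.1 (Finset.mem_coe.1 hi')).2
      exact Prod.ext (h1.trans h2.symm) heq
    rw [← Finset.card_image_of_injOn hinj]
    refine card_le_of_sub_le (by positivity) fun x hx x' hx' => ?_
    obtain ⟨i, hi, rfl⟩ := Finset.mem_image.1 hx
    obtain ⟨i', hi', rfl⟩ := Finset.mem_image.1 hx'
    rw [Finset.mem_filter] at hi hi'
    have h1 := him' i hi.1 i' hi'.1 (hi.2.trans hi'.2.symm)
    rw [le_div_iff₀ (by norm_num)]
    rcases le_total ((i.2 : ℝ) - i'.2) 0 with h | h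
    · linarith
    · nlinarith
  have hcard : (I.card : ℝ) ≤ ((δ + 3 * σ / 2) / (2 * σ) + 1) * ((δ + 1 / 2) / 6 + 1) := by
    rw [Finset.card_eq_sum_card_image Prod.fst I]
    push_cast
    refine (Finset.sum_le_sum fun j _ => hsnd j).trans ?_
    rw [Finset.sum_const, nsmul_eq_mul]
    gcongr
  refine hcard.trans ?_
  have h1 : (δ + 3 * σ / 2) / (2 * σ) + 1 ≤ 4 * δ / σ := by
    rw [div_add_one (by positivity), div_le_div_iff₀ (by positivity) hσ]
    nlinarith
  have h2 : (δ + 1 / 2) / 6 + 1 ≤ 5 / 4 * max 1 δ := by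
    have := le_max_left 1 δ
    have := le_max_right 1 δ
    linarith
  calc _ ≤ 4 * δ / σ * (5 / 4 * max 1 δ) := by gcongr
    _ = _ := by ring

open MeasureTheory in
/-- The intervals on which a function is forced to have small derivative have small total length. -/
theorem card_mul_le_of_small_deriv {X X' : ℝ → ℝ} {α S η σ : ℝ} (hη : 0 ≤ η)
    (hσ : 0 ≤ σ)
    (hX : ∀ τ ∈ Set.Icc α S, HasDerivAt X (X' τ) τ)
    (hmeas : MeasurableSet {τ | τ ∈ Set.Icc α S ∧ |X' τ| < η}) {a : ℝ} {J : Finset ℤ}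
    (hsurj : ∀ j ∈ J, ∀ x ∈ Set.Icc (a + 2 * j * σ) (a + (2 * j + 1) * σ),
      ∃ τ ∈ Set.Icc α S, X τ = x ∧ |X' τ| < η) (hαS : α ≤ S) :
    J.card * σ ≤ η * (S - α) := by
  set Bad := {τ | τ ∈ Set.Icc α S ∧ |X' τ| < η}
  -- The image of the slow set has measure at most the integral of |X'| over it, yet it must contain
  -- all the intervals.
  have h1 : volume (X '' Bad) ≤ ENNReal.ofReal (η * (S - α)) := by
    have h2 := addHaar_image_le_lintegral_abs_det_fderiv volume hmeas (f := X)
      (f' := fun τ => ContinuousLinearMap.toSpanSingleton ℝ (X' τ))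
      (fun τ hτ => (hX τ hτ.1).hasFDerivAt.hasFDerivWithinAt)
    refine h2.trans ?_
    calc _ ≤ ∫⁻ τ in Bad, ENNReal.ofReal η := by
          refine setLIntegral_mono' hmeas fun τ hτ => ?_
          refine ENNReal.ofReal_le_ofReal ?_
          simpa using hτ.2.le
      _ = ENNReal.ofReal η * volume Bad := setLIntegral_const _ _
      _ ≤ ENNReal.ofReal η * volume (Set.Icc α S) := by
          gcongr; exact fun τ hτ => hτ.1
      _ = ENNReal.ofReal (η * (S - α)) := by
          rw [Real.volume_Icc, ENNReal.ofReal_mul hη]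
  have hdisj : Set.PairwiseDisjoint (J : Set ℤ)
      fun j : ℤ => Set.Ioo (a + 2 * j * σ) (a + (2 * j + 1) * σ) := by
    have key : ∀ j j' : ℤ, j < j' → Disjoint (Set.Ioo (a + 2 * j * σ) (a + (2 * j + 1) * σ))
        (Set.Ioo (a + 2 * j' * σ) (a + (2 * j' + 1) * σ)) := by
      intro j j' hlt
      rw [Set.disjoint_left]
      intro x hx hx'
      have h3 : (j : ℝ) + 1 ≤ j' := by exact_mod_cast hlt
      have := hx.2
      have := hx'.1
      nlinarith
    intro j _ j' _ hne
    rcases lt_or_gt_of_ne hne with h | h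
    · exact key j j' h
    · exact (key j' j h).symm
  have h2 : volume (⋃ j ∈ J, Set.Ioo (a + 2 * (j : ℝ) * σ) (a + (2 * j + 1) * σ)) =
      ENNReal.ofReal (J.card * σ) := by
    rw [measure_biUnion_finset hdisj fun j _ => measurableSet_Ioo]
    simp only [Real.volume_Ioo]
    rw [Finset.sum_congr rfl (g := fun _ => ENNReal.ofReal σ) fun j _ => by congr 1; ring,
      Finset.sum_const, nsmul_eq_mul, ENNReal.ofReal_mul (by positivity), ENNReal.ofReal_natCast]
  have h3 : ENNReal.ofReal (J.card * σ) ≤ ENNReal.ofReal (η * (S - α)) := by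
    rw [← h2]
    refine (measure_mono (Set.iUnion₂_subset fun j hj x hx => ?_)).trans h1
    obtain ⟨τ, hτ, hτx, hτη⟩ := hsurj j hj x (Set.Ioo_subset_Icc_self hx)
    exact ⟨τ, ⟨hτ, hτη⟩, hτx⟩
  exact (ENNReal.ofReal_le_ofReal_iff (mul_nonneg hη (sub_nonneg.2 hαS))).1 h3

end EntireDynamics

/-! ### Good points, good discs and the choice of parameters -/

namespace EntireDynamics

/-- A logarithmic inverse branch together with explicit growth bounds on `{T₁ ≤ re}`. -/
structure BoundedLogInverse (f : ℂ → ℂ) (ℓ : ℝ) (G : ℂ → ℂ) (T₁ C p : ℝ) : Prop where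
  toLogInverse : LogInverse f ℓ G
  lt : ℓ < T₁
  one_le : 1 ≤ T₁
  norm_deriv_mul_re_le : ∀ z : ℂ, T₁ ≤ z.re → ‖deriv G z‖ * z.re ≤ 1344
  re_le_log : ∀ t : ℝ, T₁ ≤ t → (G t).re ≤ 1344 * Real.log t + C
  log_le_re : ∀ t : ℝ, T₁ ≤ t → Real.log t ≤ (G t).re ^ p

/-- The lower bound on Re G comes from inserting exp(G t) into the growth hypothesis: |f(exp(G t))|
= exp t, while |exp(G t)| has logarithm Re G(t). -/
theorem LogInverse.exists_bounded {f G : ℂ → ℂ} {ℓ p : ℝ} (h : LogInverse f ℓ G)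
    (hf : ¬ ∃ P : Polynomial ℂ, ∀ z, f z = P.eval z)
    (hgrow : ∃ r : ℝ, 0 < r ∧ ∀ z : ℂ, r ≤ ‖z‖ →
      ‖f z‖ ≤ Real.exp (Real.exp ((Real.log ‖z‖) ^ p))) :
    ∃ T₁ C, BoundedLogInverse f ℓ G T₁ C p := by
  obtain ⟨T, hT, hder⟩ := h.norm_deriv_mul_re_le hf
  obtain ⟨C, hC⟩ := h.re_le_log hT hder
  obtain ⟨r, hr, hgrow⟩ := hgrow
  obtain ⟨T', hT', hre⟩ := h.exists_lt_re (Real.log r)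
  refine ⟨max 1 (max T T'), C, h, hT.trans_le ((le_max_left _ _).trans (le_max_right _ _)),
    le_max_left _ _, fun z hz => hder z (((le_max_left _ _).trans (le_max_right _ _)).trans hz),
    fun t ht => hC t (((le_max_left _ _).trans (le_max_right _ _)).trans ht), fun t ht => ?_⟩
  have ht1 : 1 ≤ t := (le_max_left _ _).trans ht
  have htT' : T' ≤ t := ((le_max_right _ _).trans (le_max_right _ _)).trans ht
  have h1 := hgrow (Complex.exp (G t)) (by
    rw [Complex.norm_exp, ← Real.log_le_iff_le_exp hr]
    exact (hre t (by simpa using htT')).le)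
  rw [h.map_exp t (by simpa using hT'.trans_le htT'), Complex.norm_exp, Complex.norm_exp,
    Real.log_exp, Real.exp_le_exp, Complex.ofReal_re] at h1
  rw [Real.log_le_iff_le_exp (by linarith)]
  exact h1

namespace BoundedLogInverse

variable {f G : ℂ → ℂ} {ℓ T₁ C p : ℝ}

/-- In the variable τ = log t, the function Re G takes every value in [T - κ/4, T + κ/4] before τ =
S. The range is cut into cells of length 2σ, of which only the left halves are used, so that chosen
values in different cells stay apart. Left halves met only at slow points have total length at most
κ/8. Of the at least κ/(4σ) - 1 cells at most κ/(8σ) are lost, and κ/(16σ) ≥ 1 absorbs the rounding.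
-/
theorem exists_good_points (h : BoundedLogInverse f ℓ G T₁ C p) (hp : 0 ≤ p) {T κ σ S : ℝ}
    (hσ : 0 < σ) (hσκ : 16 * σ ≤ κ) (hT₁ : (G T₁).re ≤ T - κ / 4) (hTκ : 0 ≤ T - κ / 4)
    (hS : (T + κ / 4) ^ p ≤ S) :
    ∃ J : Finset ℤ, κ / (16 * σ) ≤ J.card ∧ ∀ j ∈ J, ∃ t : ℝ, T₁ ≤ t ∧
      (G t).re ∈ Set.Icc (T - κ / 4 + 2 * j * σ) (T - κ / 4 + (2 * j + 1) * σ) ∧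
      |(G t).re - T| ≤ κ / 4 ∧ κ / (8 * S) ≤ t * ‖deriv G t‖ := by
  classical
  have hκ : 0 < κ := by linarith
  have hT₁0 : 0 < T₁ := by linarith [h.one_le]
  set a := T - κ / 4 with ha
  set α := Real.log T₁ with hα
  have hα0 : 0 ≤ α := Real.log_nonneg h.one_le
  have hexp : ∀ τ, α ≤ τ → T₁ ≤ Real.exp τ := fun τ hτ => by
    rw [← Real.exp_log hT₁0]; exact Real.exp_le_exp.2 hτ
  set X : ℝ → ℝ := fun τ => (G (Real.exp τ)).re with hX
  set X' : ℝ → ℝ := fun τ => (Real.exp τ * deriv G (Real.exp τ)).re with hX'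
  have hder : ∀ τ ∈ Set.Icc α S, HasDerivAt X (X' τ) τ := fun τ hτ =>
    h.toLogInverse.hasDerivAt_re_comp_exp (h.lt.trans_le (hexp τ hτ.1))
  set M : ℤ := ⌊κ / (4 * σ)⌋ with hM
  have hMle : (M : ℝ) ≤ κ / (4 * σ) := Int.floor_le _
  have hMlt : κ / (4 * σ) < M + 1 := Int.lt_floor_add_one _
  have hM0 : 0 ≤ M := Int.floor_nonneg.2 (by positivity)
  set J₀ : Finset ℤ := Finset.Ico 0 M with hJ₀
  have hJ₀c : (J₀.card : ℝ) = M := by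
    rw [hJ₀, Int.card_Ico, sub_zero]
    exact_mod_cast Int.toNat_of_nonneg hM0
  set P : ℤ → Prop := fun j => ∃ t : ℝ, T₁ ≤ t ∧
      (G t).re ∈ Set.Icc (a + 2 * j * σ) (a + (2 * j + 1) * σ) ∧
      |(G t).re - T| ≤ κ / 4 ∧ κ / (8 * S) ≤ t * ‖deriv G t‖ with hP
  have hrange : ∀ j ∈ J₀, ∀ x ∈ Set.Icc (a + 2 * j * σ) (a + (2 * j + 1) * σ),
      a ≤ x ∧ x ≤ T + κ / 4 := by
    intro j hj x hx
    rw [hJ₀, Finset.mem_Ico] at hj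
    have h1 : (0 : ℝ) ≤ j := by exact_mod_cast hj.1
    have h2 : (j : ℝ) + 1 ≤ M := by exact_mod_cast hj.2
    rw [le_div_iff₀ (by positivity)] at hMle
    constructor
    · nlinarith [hx.1, mul_nonneg h1 hσ.le]
    · nlinarith [hx.2, mul_le_mul_of_nonneg_right h2 hσ.le]
  have hsurj : ∀ x, a ≤ x → x ≤ T + κ / 4 → ∃ τ ∈ Set.Icc α S, X τ = x := by
    intro x hx hx'
    obtain ⟨t, ht, htx⟩ := h.toLogInverse.exists_re_eq h.lt (hT₁.trans hx)
    have ht0 : 0 < t := hT₁0.trans_le ht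
    refine ⟨Real.log t, ⟨Real.log_le_log hT₁0 ht, (h.log_le_re t ht).trans (le_trans ?_ hS)⟩, ?_⟩
    · rw [htx]; exact Real.rpow_le_rpow (hTκ.trans hx) hx' hp
    · simp only [hX, Real.exp_log ht0, htx]
  have hαS : α ≤ S := by
    obtain ⟨τ, hτ, -⟩ := hsurj a le_rfl (by rw [ha]; linarith)
    exact hτ.1.trans hτ.2
  have hS0 : 0 < S := lt_of_lt_of_le (Real.rpow_pos_of_pos (by linarith) p) hS
  have hbad := card_mul_le_of_small_deriv (X := X) (X' := X') (α := α) (S := S)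
    (η := κ / (8 * S)) (σ := σ) (by positivity) hσ.le hder ?_ (a := a)
    (J := J₀.filter fun j => ¬ P j) ?_ hαS
  · have hsum := Finset.card_filter_add_card_filter_not (s := J₀) P
    have hsum' : ((J₀.filter P).card : ℝ) + (J₀.filter fun j => ¬ P j).card = M := by
      rw [← hJ₀c]; exact_mod_cast hsum
    have hbad' : ((J₀.filter fun j => ¬ P j).card : ℝ) ≤ κ / (8 * σ) := by
      rw [le_div_iff₀ (by positivity)]
      have h1 : κ / (8 * S) * (S - α) ≤ κ / 8 := by
        rw [div_mul_eq_mul_div, div_le_div_iff₀ (by positivity) (by norm_num)]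
        nlinarith [mul_nonneg hκ.le hα0]
      linarith
    refine ⟨J₀.filter P, ?_, fun j hj => (Finset.mem_filter.1 hj).2⟩
    have h1 : κ / (4 * σ) = 4 * (κ / (16 * σ)) := by field_simp; norm_num
    have h2 : κ / (8 * σ) = 2 * (κ / (16 * σ)) := by field_simp; norm_num
    have h3 : 1 ≤ κ / (16 * σ) := by rw [le_div_iff₀ (by positivity)]; linarith
    linarith
  · have hopen : IsOpen {τ : ℝ | ℓ < Real.exp τ} := isOpen_lt continuous_const Real.continuous_exp
    have hc : ContinuousOn (fun τ => |X' τ|) {τ : ℝ | ℓ < Real.exp τ} := by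
      refine ContinuousOn.abs (Complex.continuous_re.comp_continuousOn
        (ContinuousOn.mul (by fun_prop) ?_))
      refine (h.toLogInverse.differentiableOn.deriv (isOpen_re_gt ℓ)).continuousOn.comp
        (by fun_prop) fun τ hτ => ?_
      rw [Set.mem_ofPred_eq, Complex.ofReal_re]; exact hτ
    have := hc.isOpen_inter_preimage hopen (isOpen_Iio (a := κ / (8 * S)))
    convert (measurableSet_Icc (a := α) (b := S)).inter this.measurableSet using 1
    ext τ
    constructor
    · rintro ⟨h1, h2⟩
      exact ⟨h1, h.lt.trans_le (hexp τ h1.1), h2⟩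
    · rintro ⟨h1, -, h2⟩
      exact ⟨h1, h2⟩
  · intro j hj x hx
    rw [Finset.mem_filter] at hj
    obtain ⟨hax, hxb⟩ := hrange j hj.1 x hx
    obtain ⟨τ, hτ, hτx⟩ := hsurj x hax hxb
    refine ⟨τ, hτ, hτx, ?_⟩
    by_contra hge
    rw [not_lt] at hge
    refine hj.2 ⟨Real.exp τ, hexp τ hτ.1, ?_, ?_, hge.trans ?_⟩
    · rw [show (G (Real.exp τ)).re = x from hτx]; exact hx
    · rw [show (G (Real.exp τ)).re = x from hτx, abs_le]
      constructor <;> linarith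
    · refine (Complex.abs_re_le_norm _).trans ?_
      rw [norm_mul, Complex.norm_real, Real.norm_of_nonneg (Real.exp_pos τ).le]

/-- The small-distortion disc is taken around t at scale r = t/2, where M = 1344 is the derivative
bound. Since |G'(z)| Re z ≤ 1344 too, an image of size about σ forces a radius of at least about σ
Re z; 430080 = 1344 · 8 · 40. -/
theorem exists_child (h : BoundedLogInverse f ℓ G T₁ C p) {t η σ : ℝ} (ht : 2 * T₁ ≤ t)
    (ht' : 10000 ≤ t) (hη : 0 < η) (hηt : η ≤ t * ‖deriv G t‖) (hσ : 0 < σ)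
    (hση : σ ≤ η / 2) {n : ℕ} (hn : (σ / (2 * η)) ^ n * 1344 ≤ η / 2) :
    ∃ (z : ℂ) (ρ l : ℝ), 0 < ρ ∧ 0 < l ∧ t / 2 ≤ z.re ∧ ρ ≤ z.re / 4 ∧
      σ * z.re / (430080 * 4 ^ n) ≤ ρ ∧ σ / (400 * 4 ^ n) ≤ l * ρ ∧
      (∀ x ∈ Metric.closedBall z ρ, ℓ < x.re ∧ ‖G x - G t‖ ≤ σ / 4) ∧
      ∀ x ∈ Metric.closedBall z ρ, ∀ y ∈ Metric.closedBall z ρ,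
        l * ‖x - y‖ ≤ ‖G x - G y‖ ∧ ‖G x - G y‖ ≤ ‖x - y‖ / 2 := by
  have hT₁0 : 0 < T₁ := by linarith [h.one_le]
  have ht0 : 0 < t := by linarith
  have hre : ∀ x : ℂ, ∀ d, dist x t ≤ d → t - d ≤ x.re := by
    intro x d hx
    rw [dist_eq_norm] at hx
    have := (abs_le.1 (Complex.abs_re_le_norm (x - t))).1
    rw [Complex.sub_re, Complex.ofReal_re] at this
    linarith
  obtain ⟨z, ρ, hρ, hball, hlow⟩ := exists_disc_small_distortion (isOpen_re_gt ℓ)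
    h.toLogInverse.differentiableOn (c := t) (r := t / 2) (M := 1344) (η := η / 2) (σ := σ / 8)
    (by positivity) (fun x hx => by
      have := hre x _ hx
      exact h.lt.trans_le (by linarith)) (fun x hx => by
      have h1 := hre x _ hx
      have h2 := h.norm_deriv_mul_re_le x (by linarith)
      nlinarith [norm_nonneg (deriv G x)]) (by positivity) (by linarith) (by positivity)
    (by linarith) (n := n) (by
      rw [show 2 * (σ / 8) / (η / 2) = σ / (2 * η) by field_simp; norm_num]; exact hn)
  have hzre := hre z _ (hball z (Metric.mem_closedBall_self hρ.le)).1
  -- The opposite points z ± ρ both lie within t/8 of t.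
  have hρt : ρ ≤ t / 8 := by
    have h1 := (hball (z + ρ) (by simp [abs_of_pos hρ])).1
    have h2 := (hball (z - ρ) (by simp [abs_of_pos hρ])).1
    have h3 := dist_triangle_right (z + ρ) (z - ρ) t
    have h4 : dist (z + ρ) (z - ρ) = 2 * ρ := by
      rw [dist_eq_norm, show z + (ρ : ℂ) - (z - ρ) = ((2 * ρ : ℝ) : ℂ) by push_cast; ring,
        Complex.norm_real, Real.norm_of_nonneg (by positivity)]
    linarith
  have hzpos : 0 < z.re := by linarith
  set D := ‖deriv G z‖ with hD
  have hσn : 0 < σ / 8 / (40 * 4 ^ n) := by positivity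
  have hD0 : 0 < D := pos_of_mul_pos_right (hσn.trans_le hlow) hρ.le
  have hDz : D * z.re ≤ 1344 := h.norm_deriv_mul_re_le z (by linarith)
  have hdiff : ∀ x ∈ Metric.closedBall z ρ, DifferentiableAt ℂ G x := fun x hx =>
    h.toLogInverse.differentiableAt (by linarith [hre x _ (hball x hx).1, h.lt])
  refine ⟨z, ρ, 9 / 10 * D, hρ, by positivity, by linarith, by linarith, ?_, ?_, ?_, ?_⟩
  · rw [div_le_iff₀ (by positivity)]
    rw [div_le_iff₀ (by positivity)] at hlow
    have h4 : (0 : ℝ) < 4 ^ n := by positivity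
    nlinarith [mul_le_mul_of_nonneg_left hDz (show 0 ≤ ρ * 4 ^ n by positivity),
      mul_le_mul_of_nonneg_right hlow hzpos.le]
  · rw [div_le_iff₀ (by positivity)]
    rw [div_le_iff₀ (by positivity)] at hlow
    have h4 : (0 : ℝ) < ρ * D * 4 ^ n := by positivity
    nlinarith
  · intro x hx
    have := hball x hx
    exact ⟨by linarith [hre x _ this.1, h.lt], by linarith [this.2.1]⟩
  · intro x hx y hy
    have h1 := norm_sub_sub_mul_le (convex_closedBall z ρ) hdiff
      (fun x hx => (hball x hx).2.2) hx hy
    have h2 := norm_le_insert (G x - G y) (deriv G z * (x - y))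
    have h3 := norm_le_insert' (G x - G y) (deriv G z * (x - y))
    rw [norm_mul, ← hD] at h2 h3
    have h5 : D ≤ 1 / 4 := by nlinarith
    have h6 := norm_nonneg (x - y)
    constructor <;> nlinarith

end BoundedLogInverse

set_option maxHeartbeats 800000 in
/-- The parameter inequalities that hold when the real part `T` of the centre is large. -/
theorem eventually_parameters {q s d C T₁ C' E x₀ : ℝ} (hq : 1 ≤ q) (hs : 1 < s)
    (hd : d = 1 + q - q * s) (hd0 : 0 < d) (hC' : 0 < C') {n : ℕ} (hn : 8 * (q + 1) / d ≤ n) :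
    ∀ᶠ T : ℝ in atTop, 64 ≤ T ∧ x₀ ≤ T / 2 ∧ ∀ κ, T ^ (1 - d / 8) ≤ κ → κ ≤ T / 4 →
      ∃ σ S, 0 < σ ∧ σ ≤ 1 ∧ 0 < S ∧ 16 ≤ κ ∧ (2 * T) ^ (q + d / 8) = S ∧
      σ ≤ κ / (8 * S) / 2 ∧ (σ / (2 * (κ / (8 * S)))) ^ n * 1344 ≤ κ / (8 * S) / 2 ∧
      E ≤ σ ^ (s - 1) * κ ^ (2 - s) ∧
      ∀ t, 0 < t → T / 2 ≤ 1344 * Real.log t + C → 4 * T ≤ t ∧ 2 * T₁ ≤ t ∧ 10000 ≤ t ∧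
        ∀ y, t / 2 ≤ y → y ^ (1 - d / 8) ≤ σ * y / C' := by
  have hd1 : d < 1 := by nlinarith
  have hs2 : s ≤ 2 := by nlinarith
  set A : ℝ := 2 ^ (q + d / 8) with hA
  have hA1 : 1 ≤ A := Real.one_le_rpow (by norm_num) (by linarith)
  set m : ℝ := (q - 1 + d / 2) * (8 / d) with hm
  set b : ℝ := 1 / 2688 with hb
  have e1 : ∀ x : ℝ, ∀ᶠ T : ℝ in atTop, x ≤ T := eventually_ge_atTop
  have e2 : ∀ y : ℝ, 0 < y → ∀ x : ℝ, ∀ᶠ T : ℝ in atTop, x ≤ T ^ y := fun y hy x =>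
    (tendsto_rpow_atTop hy).eventually_ge_atTop x
  have e3 : ∀ (y x : ℝ), ∀ᶠ T : ℝ in atTop, x ≤ Real.exp (b * T) / T ^ y := fun y x =>
    (tendsto_exp_mul_div_rpow_atTop y b (by norm_num [hb])).eventually_ge_atTop x
  filter_upwards [e1 64, e1 (2 * x₀), e1 (1344 * 16 * A), e2 (d / 8) (by positivity) (16 * A),
    e2 (3 * d / 8) (by positivity) E, e2 (1 - d / 8) (by linarith) 16,
    e3 1 (4 * Real.exp (C / 1344)), e3 0 (max (2 * T₁) 10000 * Real.exp (C / 1344)),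
    e3 m (2 * C' ^ (8 / d) * Real.exp (C / 1344))] with T h64 hx0 hTA hLA hTE h16 hE1 hE0 hEm
  have hT0 : 0 < T := by linarith
  have hT1 : 1 ≤ T := by linarith
  refine ⟨h64, by linarith, fun κ hκ hκT => ?_⟩
  -- L is the unit of slack: κ ≥ T/L, S = A T^q L and σ = T/(T^q L⁴). Hence σ divided by κ/(8S) is
  -- at most 8A/L², with A ≤ L/16, and L^n ≥ T^(q+1) makes its n-th power small enough.
  set L : ℝ := T ^ (d / 8) with hL
  have hL0 : 0 < L := Real.rpow_pos_of_pos hT0 _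
  set Tq : ℝ := T ^ q with hTq
  have hTq0 : 0 < Tq := Real.rpow_pos_of_pos hT0 _
  set σ : ℝ := T ^ (-(q - 1 + d / 2)) with hσ
  have hσ0 : 0 < σ := Real.rpow_pos_of_pos hT0 _
  have hσeq : σ = T / (Tq * L ^ 4) := by
    have : L ^ 4 = T ^ (d / 2) := by
      rw [hL, ← Real.rpow_natCast, ← Real.rpow_mul hT0.le]; congr 1; push_cast; ring
    rw [this, hTq, ← Real.rpow_add hT0, eq_div_iff (Real.rpow_pos_of_pos hT0 _).ne', hσ,
      ← Real.rpow_add hT0]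
    conv_rhs => rw [← Real.rpow_one T]
    congr 1; ring
  have hSeq : (2 * T) ^ (q + d / 8) = A * (Tq * L) := by
    rw [Real.mul_rpow (by norm_num) hT0.le, Real.rpow_add hT0]
  have hκL : T / L ≤ κ := by
    rw [hL, ← Real.rpow_one T, ← Real.rpow_mul hT0.le, ← Real.rpow_sub hT0]
    simpa using hκ
  have hκ0 : 0 < κ := (by positivity : 0 < T / L).trans_le hκL
  have hL2 : L ^ 2 ≤ T := by
    rw [hL, ← Real.rpow_natCast, ← Real.rpow_mul hT0.le]
    conv_rhs => rw [← Real.rpow_one T]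
    exact Real.rpow_le_rpow_of_exponent_le hT1 (by push_cast; linarith)
  have hLn : Tq * T ≤ L ^ n := by
    rw [hL, hTq, ← Real.rpow_natCast, ← Real.rpow_mul hT0.le]
    conv_lhs => rw [← Real.rpow_one T, ← Real.rpow_mul hT0.le, ← Real.rpow_add hT0]
    refine Real.rpow_le_rpow_of_exponent_le hT1 ?_
    rw [div_le_iff₀ hd0] at hn
    linarith
  have hS0 : 0 < A * (Tq * L) := by positivity
  refine ⟨σ, A * (Tq * L), hσ0, Real.rpow_le_one_of_one_le_of_nonpos hT1 (by linarith), hS0,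
    h16.trans hκ, hSeq, ?_, ?_, ?_, ?_⟩
  · rw [div_div, le_div_iff₀ (by positivity)]
    refine le_trans ?_ hκL
    rw [hσeq, le_div_iff₀ hL0]
    have : T / (Tq * L ^ 4) * (8 * (A * (Tq * L)) * 2) * L = T * (16 * A / L ^ 2) := by
      field_simp; ring
    rw [this]
    refine mul_le_of_le_one_right hT0.le ?_
    rw [div_le_one (by positivity)]
    nlinarith
  · have h1 : σ / (2 * (κ / (8 * (A * (Tq * L))))) ≤ 1 / L := by
      have h2 : σ / (2 * (κ / (8 * (A * (Tq * L))))) = 4 * A * T / (L ^ 3 * κ) := by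
        rw [hσeq]; field_simp; ring
      rw [h2, div_le_div_iff₀ (by positivity) hL0]
      have h3 : T ≤ κ * L := by rwa [div_le_iff₀ hL0] at hκL
      calc 4 * A * T * L ≤ L * T * L := by gcongr; linarith
        _ ≤ L * (κ * L) * L := by gcongr
        _ = 1 * (L ^ 3 * κ) := by ring
    have h2 : T / L / (8 * (A * (Tq * L))) / 2 ≤ κ / (8 * (A * (Tq * L))) / 2 := by gcongr
    refine le_trans ?_ h2
    calc (σ / (2 * (κ / (8 * (A * (Tq * L)))))) ^ n * 1344 ≤ (1 / L) ^ n * 1344 := by gcongr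
      _ = 1344 / L ^ n := by rw [one_div, inv_pow]; ring
      _ ≤ 1344 / (Tq * T) := by gcongr
      _ ≤ T / (16 * A * Tq * T) := by
        rw [div_le_div_iff₀ (by positivity) (by positivity)]
        nlinarith [mul_le_mul_of_nonneg_right hTA (show 0 ≤ Tq * T by positivity)]
      _ ≤ T / (16 * A * Tq * L ^ 2) := by gcongr
      _ = T / L / (8 * (A * (Tq * L))) / 2 := by field_simp; norm_num
  · have h1 : (T ^ (1 - d / 8)) ^ (2 - s) ≤ κ ^ (2 - s) :=
      Real.rpow_le_rpow (Real.rpow_nonneg hT0.le _) hκ (by linarith)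
    refine hTE.trans (le_trans ?_ (mul_le_mul_of_nonneg_left h1 (Real.rpow_nonneg hσ0.le _)))
    rw [hσ, ← Real.rpow_mul hT0.le, ← Real.rpow_mul hT0.le, ← Real.rpow_add hT0]
    refine Real.rpow_le_rpow_of_exponent_le hT1 ?_
    -- This exponent is at least d - d/2 - d/8 = 3d/8 > 0. Here s < 1 + 1/q enters.
    have h2 : -(q - 1 + d / 2) * (s - 1) + (1 - d / 8) * (2 - s) =
        d - d / 2 * (s - 1) - d / 8 * (2 - s) := by rw [hd]; ring
    have h3 : d / 2 * (s - 1) ≤ d / 2 * 1 := by gcongr; linarith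
    have h4 : d / 8 * (2 - s) ≤ d / 8 * 1 := by gcongr; linarith
    linarith
  · intro t ht0 ht
    -- t is exponentially large in T, so it beats every power of T. This is why a child disc is
    -- again admissible.
    have hexp : Real.exp (b * T) / Real.exp (C / 1344) ≤ t := by
      rw [← Real.exp_sub, ← Real.le_log_iff_exp_le ht0, hb]
      linarith
    have hlow : ∀ x y : ℝ, x * Real.exp (C / 1344) ≤ Real.exp (b * T) / T ^ y → x * T ^ y ≤ t := by
      intro x y hxy
      refine le_trans ?_ hexp
      have := Real.rpow_pos_of_pos hT0 y
      rw [le_div_iff₀ this] at hxy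
      rw [le_div_iff₀ (Real.exp_pos _)]
      linarith
    have h1 := hlow 4 1 hE1
    have h0 := hlow _ 0 hE0
    have hm := hlow (2 * C' ^ (8 / d)) m hEm
    rw [Real.rpow_one] at h1
    rw [Real.rpow_zero, mul_one] at h0
    refine ⟨h1, (le_max_left _ _).trans h0, (le_max_right _ _).trans h0, fun y hy => ?_⟩
    have hy0 : 0 < y := by linarith
    have hy1 : (C' * T ^ (q - 1 + d / 2)) ^ (8 / d) ≤ y := by
      rw [Real.mul_rpow hC'.le (Real.rpow_nonneg hT0.le _), ← Real.rpow_mul hT0.le]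
      linarith
    have hy2 : C' * T ^ (q - 1 + d / 2) ≤ y ^ (d / 8) := by
      have h3 := Real.rpow_le_rpow (by positivity) hy1 (show 0 ≤ d / 8 by positivity)
      rwa [← Real.rpow_mul (by positivity), show 8 / d * (d / 8) = 1 by field_simp,
        Real.rpow_one] at h3
    have hσ' : σ = (T ^ (q - 1 + d / 2))⁻¹ := by rw [hσ, Real.rpow_neg hT0.le]
    have hTp := Real.rpow_pos_of_pos hT0 (q - 1 + d / 2)
    rw [Real.rpow_sub hy0, Real.rpow_one, le_div_iff₀ hC', hσ',
      div_mul_eq_mul_div, div_le_iff₀ (Real.rpow_pos_of_pos hy0 _), inv_mul_eq_div,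
      div_mul_eq_mul_div, le_div_iff₀ hTp]
    nlinarith [mul_le_mul_of_nonneg_left hy2 hy0.le]

end EntireDynamics

/-! ### The children of an admissible disc -/

namespace EntireDynamics

theorem exists_int_abs_add_le (x : ℝ) : ∃ k : ℤ, |x + 2 * Real.pi * k| ≤ Real.pi := by
  refine ⟨-round (x / (2 * Real.pi)), ?_⟩
  have h := abs_sub_round (x / (2 * Real.pi))
  have hp := Real.pi_pos
  have : x + 2 * Real.pi * ((-round (x / (2 * Real.pi)) : ℤ) : ℝ) =
      2 * Real.pi * (x / (2 * Real.pi) - round (x / (2 * Real.pi))) := by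
    push_cast; field_simp; ring
  rw [this, abs_mul, abs_of_pos (by positivity)]
  nlinarith

/-- Separation condition for a set of diameter δ meeting m of the N children. For δ ≥ κ it follows
from m ≤ N. For 1 ≤ δ ≤ κ the count is quadratic in δ and s ≤ 2 suffices. For δ ≤ 1 it is linear,
and δ ≥ σ/2 together with the condition on σ^(s-1) κ^(2-s) is used. The constant is 1280 = 5 · 256.
-/
theorem rpow_mul_card_div_le {s σ κ δ m N : ℝ} (hs1 : 1 < s) (hs2 : s ≤ 2) (hσ : 0 < σ)
    (hκ : 1 ≤ κ) (hE : 2 ≤ σ ^ (s - 1) * κ ^ (2 - s)) (hδ : σ / 2 ≤ δ) (hm0 : 0 ≤ m)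
    (hm : m ≤ 5 * δ * max 1 δ / σ) (hmN : m ≤ N) (hN : κ / (16 * σ) * (κ / 16) ≤ N) :
    1 / 1280 * κ ^ s * m / N ≤ δ ^ s := by
  have hκ0 : 0 < κ := by linarith
  have hδ0 : 0 < δ := by linarith
  have hN0 : 0 < N := lt_of_lt_of_le (by positivity) hN
  have hκs : 0 < κ ^ s := Real.rpow_pos_of_pos hκ0 s
  have hκ2 : κ ^ s = κ ^ 2 * κ ^ (s - 2) := by
    rw [← Real.rpow_natCast κ 2, ← Real.rpow_add hκ0]; congr 1; push_cast; ring
  rcases le_total κ δ with h | h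
  · have h1 : m / N ≤ 1 := (div_le_one hN0).2 hmN
    have h2 : κ ^ s ≤ δ ^ s := Real.rpow_le_rpow hκ0.le h (by linarith)
    rw [mul_div_assoc]
    have := mul_le_mul_of_nonneg_left h1 hκs.le
    nlinarith
  have hmN' : m / N ≤ 1280 * (δ * max 1 δ) / κ ^ 2 := by
    rw [div_le_div_iff₀ hN0 (by positivity)]
    have h1 : κ ^ 2 ≤ 256 * σ * N := by
      have : 256 * σ * (κ / (16 * σ) * (κ / 16)) = κ ^ 2 := by field_simp; norm_num
      nlinarith
    rw [le_div_iff₀ hσ] at hm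
    nlinarith [mul_le_mul_of_nonneg_left h1 hm0]
  have hmain : 1 / 1280 * κ ^ s * m / N ≤ κ ^ (s - 2) * (δ * max 1 δ) := by
    rw [mul_div_assoc]
    refine (mul_le_mul_of_nonneg_left hmN' (by positivity)).trans_eq ?_
    rw [hκ2]; field_simp
  refine hmain.trans ?_
  rcases le_total 1 δ with h1 | h1
  · rw [max_eq_right h1]
    have h2 : κ ^ (s - 2) ≤ δ ^ (s - 2) := Real.rpow_le_rpow_of_nonpos hδ0 h (by linarith)
    have h3 : δ ^ s = δ ^ 2 * δ ^ (s - 2) := by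
      rw [← Real.rpow_natCast δ 2, ← Real.rpow_add hδ0]; congr 1; push_cast; ring
    rw [h3]
    nlinarith [sq_nonneg δ]
  · rw [max_eq_left h1, mul_one]
    have h3 : δ ^ s = δ ^ (s - 1) * δ := by
      conv_rhs => rw [← Real.rpow_one δ, ← Real.rpow_mul hδ0.le, ← Real.rpow_add hδ0]
      congr 1; ring
    rw [h3]
    refine mul_le_mul_of_nonneg_right ?_ hδ0.le
    have h4 : (σ / 2) ^ (s - 1) ≤ δ ^ (s - 1) :=
      Real.rpow_le_rpow (by positivity) hδ (by linarith)
    refine le_trans ?_ h4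
    rw [Real.div_rpow hσ.le (by norm_num), le_div_iff₀ (Real.rpow_pos_of_pos (by norm_num) _)]
    have h5 : (2 : ℝ) ^ (s - 1) ≤ 2 := by
      conv_rhs => rw [← Real.rpow_one 2]
      exact Real.rpow_le_rpow_of_exponent_le (by norm_num) (by linarith)
    have h6 : κ ^ (s - 2) * κ ^ (2 - s) = 1 := by
      rw [← Real.rpow_add hκ0]; simp
    have h7 : 0 < κ ^ (s - 2) := Real.rpow_pos_of_pos hκ0 _
    calc κ ^ (s - 2) * 2 ^ (s - 1) ≤ κ ^ (s - 2) * 2 := by gcongr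
      _ ≤ κ ^ (s - 2) * (σ ^ (s - 1) * κ ^ (2 - s)) := by gcongr
      _ = σ ^ (s - 1) * (κ ^ (s - 2) * κ ^ (2 - s)) := by ring
      _ = σ ^ (s - 1) := by rw [h6, mul_one]

/-- Mass balance: with N ≥ κ²/(256σ) children of size at least σ/c, the claim reduces to the assumed
lower bound on σ^(s-1) κ^(2-s). -/
theorem rpow_div_card_le {s σ κ l ρ N c : ℝ} (hs : 1 < s) (hσ : 0 < σ) (hκ : 0 < κ)
    (hc : 0 < c) (hE : 256 * c ^ s ≤ σ ^ (s - 1) * κ ^ (2 - s)) (hl : 0 < l) (hρ : 0 < ρ)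
    (hlρ : σ / c ≤ l * ρ) (hN : κ / (16 * σ) * (κ / 16) ≤ N) :
    κ ^ s / N ≤ l ^ s * ρ ^ s := by
  have hN0 : 0 < N := lt_of_lt_of_le (by positivity) hN
  rw [← Real.mul_rpow hl.le hρ.le]
  refine le_trans ?_ (Real.rpow_le_rpow (by positivity) hlρ (by linarith))
  have hcs : 0 < c ^ s := Real.rpow_pos_of_pos hc s
  rw [Real.div_rpow hσ.le hc.le, div_le_div_iff₀ hN0 hcs]
  have h1 : κ ^ 2 ≤ 256 * σ * N := by
    have : 256 * σ * (κ / (16 * σ) * (κ / 16)) = κ ^ 2 := by field_simp; norm_num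
    nlinarith
  have h2 : κ ^ s * κ ^ (2 - s) = κ ^ 2 := by
    rw [← Real.rpow_add hκ, ← Real.rpow_natCast κ 2]; congr 1; push_cast; ring
  have h3 : σ ^ s = σ ^ (s - 1) * σ := by
    conv_rhs => rw [← Real.rpow_one σ, ← Real.rpow_mul hσ.le, ← Real.rpow_add hσ]
    congr 1; ring
  have hκs : 0 < κ ^ s := Real.rpow_pos_of_pos hκ s
  have hσs : 0 < σ ^ (s - 1) := Real.rpow_pos_of_pos hσ _
  have h4 : 256 * (κ ^ s * c ^ s) ≤ σ ^ (s - 1) * κ ^ 2 := by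
    rw [← h2]
    nlinarith [mul_le_mul_of_nonneg_left hE hκs.le]
  rw [h3]
  nlinarith [mul_le_mul_of_nonneg_left h1 hσs.le]

namespace BoundedLogInverse

variable {f G : ℂ → ℂ} {ℓ T₁ C : ℝ}

theorem exists_children {q s d : ℝ} (h : BoundedLogInverse f ℓ G T₁ C (q + d / 8)) (hq : 1 ≤ q)
    (hs : 1 < s) (hd : d = 1 + q - q * s) (hd0 : 0 < d) :
    ∃ T₀ : ℝ, 64 ≤ T₀ ∧ (∀ T ≥ T₀, 16 ≤ T ^ (1 - d / 8) ∧ T ^ (1 - d / 8) ≤ T / 4) ∧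
      ∀ (c : ℂ) (κ : ℝ), T₀ ≤ c.re → c.re ^ (1 - d / 8) ≤ κ →
      κ ≤ c.re / 4 → ∃ (I : Finset (ℤ × ℤ)) (z : ℤ × ℤ → ℂ) (ρ l : ℤ × ℤ → ℝ) (k : ℤ × ℤ → ℤ),
        1 < I.card ∧
        (∀ i ∈ I, 2 * c.re ≤ (z i).re ∧ (z i).re ^ (1 - d / 8) ≤ ρ i ∧ ρ i ≤ (z i).re / 4 ∧
          0 < l i ∧ κ ^ s / I.card ≤ l i ^ s * ρ i ^ s ∧
          (∀ x ∈ Metric.closedBall (z i) (ρ i), ℓ < x.re ∧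
            G x + k i * (2 * Real.pi * Complex.I) ∈ Metric.closedBall c κ) ∧
          ∀ x ∈ Metric.closedBall (z i) (ρ i), ∀ y ∈ Metric.closedBall (z i) (ρ i),
            l i * ‖x - y‖ ≤ ‖G x - G y‖ ∧ ‖G x - G y‖ ≤ ‖x - y‖ / 2 ∧ ‖G x - G y‖ ≤ 1) ∧
        ∀ U : Set ℂ, Bornology.IsBounded U → ∀ I' ⊆ I, 1 < I'.card →
          (∀ i ∈ I', ∃ x ∈ Metric.closedBall (z i) (ρ i),
            G x + k i * (2 * Real.pi * Complex.I) ∈ U) →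
          1 / 1280 * κ ^ s * I'.card / I.card ≤ Metric.diam U ^ s := by
  have hd1 : d < 1 := by nlinarith
  have hs2 : s ≤ 2 := by nlinarith
  obtain ⟨n, hn⟩ := exists_nat_ge (8 * (q + 1) / d)
  have hE0 : 0 < 256 * (400 * 4 ^ n : ℝ) ^ s := by positivity
  -- The summand 2 of E serves the separation condition, the other one the mass balance.
  have hev := eventually_parameters (C := C) (T₁ := T₁) (x₀ := (G T₁).re)
    (E := 2 + 256 * (400 * 4 ^ n) ^ s) (C' := 430080 * 4 ^ n) hq hs hd hd0 (by positivity) hn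
  have hev2 : ∀ᶠ T : ℝ in atTop, 16 ≤ T ^ (1 - d / 8) ∧ T ^ (1 - d / 8) ≤ T / 4 := by
    filter_upwards [(tendsto_rpow_atTop (show 0 < 1 - d / 8 by linarith)).eventually_ge_atTop 16,
      (tendsto_rpow_atTop (show 0 < d / 8 by linarith)).eventually_ge_atTop 4,
      eventually_ge_atTop 1] with T h1 h2 h3
    refine ⟨h1, ?_⟩
    have hT0 : 0 < T := by linarith
    rw [Real.rpow_sub hT0, Real.rpow_one]
    gcongr
  obtain ⟨T₀, hT₀⟩ := eventually_atTop.1 (hev.and hev2)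
  refine ⟨T₀, (hT₀ T₀ le_rfl).1.1, fun T hT => (hT₀ T hT).2, fun c κ hc hκ hκ' => ?_⟩
  obtain ⟨⟨h64, hx₀, hpar⟩, -⟩ := hT₀ c.re hc
  obtain ⟨σ, S, hσ0, hσ1, hS0, hκ16, hS, hση, hn', hE, ht⟩ := hpar κ hκ hκ'
  clear hT₀ hev hev2 hpar
  set T := c.re
  have hκ0 : 0 < κ := by linarith
  obtain ⟨J, hJc, hJ⟩ := h.exists_good_points (by linarith) (T := T) (κ := κ) (σ := σ) (S := S)
    hσ0 (by linarith) (by linarith) (by linarith)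
    (hS ▸ Real.rpow_le_rpow (by linarith) (by linarith) (by linarith))
  have hchild : ∀ j ∈ J, ∃ (t : ℝ) (z : ℂ) (ρ l : ℝ) (k : ℤ),
      (G t).re ∈ Set.Icc (T - κ / 4 + 2 * j * σ) (T - κ / 4 + (2 * j + 1) * σ) ∧
      |(G t).re - T| ≤ κ / 4 ∧ |(G t).im + 2 * Real.pi * k - c.im| ≤ Real.pi ∧
      2 * T ≤ z.re ∧ z.re ^ (1 - d / 8) ≤ ρ ∧ ρ ≤ z.re / 4 ∧ 0 < ρ ∧ 0 < l ∧
      σ / (400 * 4 ^ n) ≤ l * ρ ∧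
      (∀ x ∈ Metric.closedBall z ρ, ℓ < x.re ∧ ‖G x - G t‖ ≤ σ / 4) ∧
      ∀ x ∈ Metric.closedBall z ρ, ∀ y ∈ Metric.closedBall z ρ,
        l * ‖x - y‖ ≤ ‖G x - G y‖ ∧ ‖G x - G y‖ ≤ ‖x - y‖ / 2 := by
    intro j hj
    obtain ⟨t, htT, hmem, habs, hlow⟩ := hJ j hj
    have ht0 : 0 < t := by linarith [h.one_le]
    obtain ⟨h1, h2, h3, h4⟩ := ht t ht0 (by
      linarith [h.re_le_log t htT, (abs_le.1 habs).1])
    obtain ⟨z, ρ, l, hρ, hl, hz, hρz, hρlow, hlρ, hball, hlip⟩ :=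
      h.exists_child h2 h3 (η := κ / (8 * S)) (by positivity) hlow hσ0 hση hn'
    obtain ⟨k, hk⟩ := exists_int_abs_add_le ((G t).im - c.im)
    refine ⟨t, z, ρ, l, k, hmem, habs, ?_, by linarith, (h4 z.re hz).trans hρlow, hρz, hρ, hl, hlρ,
      hball, hlip⟩
    rwa [show (G t).im + 2 * Real.pi * k - c.im = (G t).im - c.im + 2 * Real.pi * k by ring]
  choose! t z ρ l k hmem habs hk hz hzρ hρz hρ hl hlρ hball hlip using hchild
  -- Translating by at most m periods moves points by less than 6.3 κ/16. With the horizontal κ/4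
  -- and bounded errors, the images stay within κ of the centre because κ ≥ 16.
  set m : ℤ := ⌊κ / 16⌋ with hm
  have hmle : (m : ℝ) ≤ κ / 16 := Int.floor_le _
  have hmlt : κ / 16 < m + 1 := Int.lt_floor_add_one _
  have hm1 : 1 ≤ m := Int.le_floor.2 (by push_cast; linarith)
  set I : Finset (ℤ × ℤ) := J ×ˢ Finset.Icc (-m) m with hI
  have hIc : (I.card : ℝ) = J.card * (2 * m + 1) := by
    rw [hI, Finset.card_product, Int.card_Icc]
    push_cast
    congr 1
    have : ((m + 1 - -m).toNat : ℤ) = m + 1 - -m := Int.toNat_of_nonneg (by omega)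
    rw [show (((m + 1 - -m).toNat : ℕ) : ℝ) = (((m + 1 - -m).toNat : ℤ) : ℝ) from rfl, this]
    push_cast; ring
  have hN : κ / (16 * σ) * (κ / 16) ≤ I.card := by
    rw [hIc]
    gcongr
    have : (1 : ℝ) ≤ m := by exact_mod_cast hm1
    linarith
  have hIJ : ∀ i ∈ I, i.1 ∈ J ∧ |(i.2 : ℝ)| ≤ m := by
    intro i hi
    rw [hI, Finset.mem_product, Finset.mem_Icc] at hi
    refine ⟨hi.1, abs_le.2 ⟨?_, ?_⟩⟩
    · exact_mod_cast hi.2.1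
    · exact_mod_cast hi.2.2
  have hre : ∀ (x : ℂ) (i : ℤ), (G x + i * (2 * Real.pi * Complex.I)).re = (G x).re := by
    intro x i; simp
  have him : ∀ (x : ℂ) (i : ℤ),
      (G x + i * (2 * Real.pi * Complex.I)).im = (G x).im + 2 * Real.pi * i := by
    intro x i; simp; ring
  have hclose : ∀ j ∈ J, ∀ x ∈ Metric.closedBall (z j) (ρ j),
      |(G x).re - (G (t j)).re| ≤ σ / 4 ∧ |(G x).im - (G (t j)).im| ≤ σ / 4 := by
    intro j hj x hx
    have h1 := (hball j hj x hx).2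
    rw [← Complex.sub_re, ← Complex.sub_im]
    exact ⟨(Complex.abs_re_le_norm _).trans h1, (Complex.abs_im_le_norm _).trans h1⟩
  refine ⟨I, fun i => z i.1, fun i => ρ i.1, fun i => l i.1, fun i => k i.1 + i.2, ?_, ?_, ?_⟩
  · have h1 : (1 : ℝ) < I.card := by
      have h2 : (1 : ℝ) ≤ J.card :=
        ((one_le_div (by positivity)).2 (by linarith)).trans hJc
      have h3 : (1 : ℝ) ≤ m := by exact_mod_cast hm1
      rw [hIc]
      nlinarith
    exact_mod_cast h1
  · intro i hi
    obtain ⟨hj, hi2⟩ := hIJ i hi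
    refine ⟨hz _ hj, hzρ _ hj, hρz _ hj, hl _ hj, ?_, fun x hx => ⟨(hball _ hj x hx).1, ?_⟩,
      fun x hx y hy => ⟨(hlip _ hj x hx y hy).1, (hlip _ hj x hx y hy).2, ?_⟩⟩
    · exact rpow_div_card_le hs hσ0 hκ0 (c := 400 * 4 ^ n) (by positivity) (by linarith) (hl _ hj)
        (hρ _ hj) (hlρ _ hj) hN
    · obtain ⟨h1, h2⟩ := hclose _ hj x hx
      rw [Metric.mem_closedBall, dist_eq_norm]
      refine (Complex.norm_le_abs_re_add_abs_im _).trans ?_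
      rw [Complex.sub_re, Complex.sub_im, hre, him]
      have h3 : |(G x).re - c.re| ≤ κ / 4 + 1 / 4 := by
        have h4 := abs_le.1 (habs _ hj)
        have h5 := abs_le.1 h1
        rw [abs_le]
        constructor <;> linarith
      have h6 : |(G x).im + 2 * Real.pi * ((k i.1 + i.2 : ℤ) : ℝ) - c.im| ≤
          1 / 4 + 3.15 + 6.3 * (κ / 16) := by
        have h7 := abs_le.1 (hk _ hj)
        have h8 := abs_le.1 h2
        have h9 := abs_le.1 hi2
        have hpi := Real.pi_pos
        have hpi' : Real.pi < 3.15 := Real.pi_lt_d2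
        have h10 : |2 * Real.pi * (i.2 : ℝ)| ≤ 6.3 * (κ / 16) := by
          rw [abs_mul, abs_of_pos (by positivity)]
          refine mul_le_mul (by linarith) (hi2.trans hmle) (abs_nonneg _) (by norm_num)
        have h11 := abs_le.1 h10
        push_cast
        rw [abs_le]
        constructor <;> linarith
      linarith
    · have h1 := (hball _ hj x hx).2
      have h2 := (hball _ hj y hy).2
      have h3 := norm_sub_le_norm_sub_add_norm_sub (G x) (G (t i.1)) (G y)
      rw [norm_sub_rev (G (t i.1))] at h3
      linarith
  · intro U hU I' hI' hI'c hmeet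
    choose! x hx hxU using hmeet
    -- The offset σ/2 places the reference values at the midpoints of the left half-cells. The
    -- tolerance 3σ/4 is σ/2 for the half-cell plus σ/4 for the disc image.
    obtain ⟨h1, h2⟩ := card_le_of_close_to_lattice (I := I') (σ := σ) (δ := Metric.diam U)
      (a := T - κ / 4 + σ / 2) (y := fun j => (G (t j)).im + 2 * Real.pi * k j)
      (u := fun i => G (x i) + ((k i.1 + i.2 : ℤ) : ℂ) * (2 * Real.pi * Complex.I))
      hσ0 hσ1 (fun i hi => by
        obtain ⟨hj, -⟩ := hIJ i (hI' hi)
        have h3 := abs_le.1 (hclose _ hj _ (hx i hi)).1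
        have h4 := hmem _ hj
        rw [hre, abs_le]
        constructor <;> linarith [h4.1, h4.2]) (fun i hi => by
        obtain ⟨hj, -⟩ := hIJ i (hI' hi)
        have h3 := abs_le.1 (hclose _ hj _ (hx i hi)).2
        rw [him, abs_le]
        push_cast
        constructor <;> linarith) (fun i hi i' hi' => by
        rw [← dist_eq_norm]
        exact Metric.dist_le_diam_of_mem hU (hxU i hi) (hxU i' hi')) hI'c
    exact rpow_mul_card_div_le hs hs2 hσ0 (by linarith) (by linarith) h1 (Nat.cast_nonneg _) h2
      (by exact_mod_cast Finset.card_le_card hI') hN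

end BoundedLogInverse

end EntireDynamics

/-! ### The Cantor set in logarithmic coordinates and the Julia set -/

namespace EntireDynamics

/-- A piece system of discs in the logarithmic coordinate whose maps are branches
of the inverse of `f` there. -/
structure LogPieceSystem (ℓ : ℝ) (G : ℂ → ℂ) (B ι : Type*) extends PieceSystem B ι ℂ where
  center : B → ℂ
  radius : B → ℝ
  shift : B → ι → ℤ
  piece_eq : ∀ b, piece b = Metric.closedBall (center b) (radius b)
  map_eq : ∀ b i x, map b i x = G x + shift b i * (2 * Real.pi * Complex.I)
  le_re : ∀ b, 64 ≤ (center b).re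
  le_radius : ∀ b, 16 ≤ radius b
  radius_le : ∀ b, radius b ≤ (center b).re / 4
  two_mul_re_le : ∀ b, ∀ i ∈ index b, 2 * (center b).re ≤ (center (child b i)).re
  lt_re : ∀ b, ∀ i ∈ index b, ∀ x ∈ piece (child b i), ℓ < x.re
  norm_sub_le_half : ∀ b, ∀ i ∈ index b, ∀ x ∈ piece (child b i), ∀ y ∈ piece (child b i),
    ‖G x - G y‖ ≤ ‖x - y‖ / 2
  norm_sub_le_one : ∀ b, ∀ i ∈ index b, ∀ x ∈ piece (child b i), ∀ y ∈ piece (child b i),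
    ‖G x - G y‖ ≤ 1

/-- The vertices are all admissible discs, since every child is again admissible. The weight of a
disc of radius κ is κ^s/1280. -/
theorem BoundedLogInverse.exists_logPieceSystem {f G : ℂ → ℂ} {ℓ T₁ C q s d : ℝ}
    (h : BoundedLogInverse f ℓ G T₁ C (q + d / 8)) (hq : 1 ≤ q)
    (hs : 1 < s) (hd : d = 1 + q - q * s) (hd0 : 0 < d) :
    ∃ (B : Type) (S : LogPieceSystem ℓ G B (ℤ × ℤ)) (b : B),
      ENNReal.ofReal s ≤ dimH (S.limitSet b) := by
  classical
  obtain ⟨T₀, hT₀, hadm, hex⟩ := h.exists_children hq hs hd hd0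
  let B : Type := {b : ℂ × ℝ // T₀ ≤ b.1.re ∧ b.1.re ^ (1 - d / 8) ≤ b.2 ∧ b.2 ≤ b.1.re / 4}
  choose I z ρ l k hI hchild hsep using fun b : B => hex b.1.1 b.1.2 b.2.1 b.2.2.1 b.2.2.2
  have hB16 : ∀ b : B, 16 ≤ b.1.2 := fun b => ((hadm _ b.2.1).1).trans b.2.2.1
  let ch : B → ℤ × ℤ → B := fun b i => if hi : i ∈ I b then
    ⟨(z b i, ρ b i), by
      obtain ⟨h1, h2, h3, -⟩ := hchild b i hi
      have := b.2.1
      exact ⟨by linarith, h2, h3⟩⟩ else b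
  have hch : ∀ b i, i ∈ I b → (ch b i).1 = (z b i, ρ b i) := fun b i hi => by simp [ch, hi]
  let S : LogPieceSystem ℓ G B (ℤ × ℤ) :=
    { piece := fun b => Metric.closedBall b.1.1 b.1.2
      index := I
      child := ch
      map := fun b i x => G x + k b i * (2 * Real.pi * Complex.I)
      isCompact_piece := fun b => isCompact_closedBall _ _
      nonempty_piece := fun b => Metric.nonempty_closedBall.2 (by linarith [hB16 b])
      one_lt_card := hI
      mapsTo := fun b i hi x hx => by
        rw [hch b i hi] at hx
        exact ((hchild b i hi).2.2.2.2.2.1 x hx).2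
      continuousOn := fun b i hi => by
        rw [hch b i hi]
        refine ContinuousOn.add (fun x hx => ?_) continuousOn_const
        exact (h.toLogInverse.differentiableAt
          ((hchild b i hi).2.2.2.2.2.1 x hx).1).continuousAt.continuousWithinAt
      center := fun b => b.1.1
      radius := fun b => b.1.2
      shift := k
      piece_eq := fun b => rfl
      map_eq := fun b i x => rfl
      le_re := fun b => hT₀.trans b.2.1
      le_radius := hB16
      radius_le := fun b => b.2.2.2
      two_mul_re_le := fun b i hi => by
        rw [hch b i hi]
        exact (hchild b i hi).1
      lt_re := fun b i hi x hx => by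
        rw [hch b i hi] at hx
        exact ((hchild b i hi).2.2.2.2.2.1 x hx).1
      norm_sub_le_half := fun b i hi x hx y hy => by
        rw [hch b i hi] at hx hy
        exact ((hchild b i hi).2.2.2.2.2.2 x hx y hy).2.1
      norm_sub_le_one := fun b i hi x hx y hy => by
        rw [hch b i hi] at hx hy
        exact ((hchild b i hi).2.2.2.2.2.2 x hx y hy).2.2 }
  have hv : ∀ b : B, 0 < 1 / 1280 * b.1.2 ^ s := fun b => by
    have := Real.rpow_pos_of_pos (show 0 < b.1.2 by linarith [hB16 b]) s
    positivity
  let b₀ : B := ⟨((T₀ : ℂ), T₀ ^ (1 - d / 8)), by simp [(hadm T₀ le_rfl).2]⟩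
  refine ⟨B, S, b₀, le_dimH_of_forall_finite_cover (S.isCompact_limitSet b₀) (by linarith)
    (hv b₀) fun F U hU hcov => ?_⟩
  refine S.le_sum_diam_rpow_of_cover (s := s) (v := fun b => 1 / 1280 * b.1.2 ^ s) (l := l)
    (by linarith) hv ?_ ?_ ?_ ?_ F.card F rfl U b₀ hU hcov
  · exact fun b i hi => (hchild b i hi).2.2.2.1
  · intro b i hi x hx y hy
    change x ∈ Metric.closedBall (ch b i).1.1 (ch b i).1.2 at hx
    change y ∈ Metric.closedBall (ch b i).1.1 (ch b i).1.2 at hy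
    rw [hch b i hi] at hx hy
    have := ((hchild b i hi).2.2.2.2.2.2 x hx y hy).1
    change l b i * dist x y ≤ dist (G x + k b i * (2 * Real.pi * Complex.I))
      (G y + k b i * (2 * Real.pi * Complex.I))
    rwa [dist_add_right, dist_eq_norm, dist_eq_norm]
  · intro b i hi
    change 1 / 1280 * b.1.2 ^ s / (I b).card ≤ l b i ^ s * (1 / 1280 * (ch b i).1.2 ^ s)
    rw [hch b i hi]
    have := (hchild b i hi).2.2.2.2.1
    calc 1 / 1280 * b.1.2 ^ s / (I b).card = 1 / 1280 * (b.1.2 ^ s / (I b).card) := by ring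
      _ ≤ 1 / 1280 * (l b i ^ s * ρ b i ^ s) := by gcongr
      _ = _ := by ring
  · intro b U hU hcard
    refine hsep b U hU _ (Finset.filter_subset _ _) hcard fun i hi => ?_
    obtain ⟨hi, y, hyU, x, hx, rfl⟩ := Finset.mem_filter.1 hi
    change x ∈ Metric.closedBall (ch b i).1.1 (ch b i).1.2 at hx
    rw [hch b i hi] at hx
    exact ⟨x, hx, hyU⟩

/-- A finite limit function is excluded by the escape of z itself, the limit ∞ by the small values
in a compact neighbourhood of z. -/
theorem mem_juliaSet_of_escaping_of_eventually_small {f : ℂ → ℂ} {z : ℂ} {R : ℝ}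
    (hz : Tendsto (fun n => ‖f^[n] z‖) atTop atTop)
    (hw : ∀ U ∈ 𝓝 z, ∀ᶠ n in atTop, ∃ w ∈ U, ‖f^[n] w‖ ≤ R) : z ∈ juliaSet f := by
  rintro ⟨U, hU, -, hzU, hnorm⟩
  obtain ⟨φ, hφ, ⟨g, hg⟩ | hinf⟩ := hnorm id
  · have h1 := (hg.tendsto_at hzU).norm
    exact not_tendsto_nhds_of_tendsto_atTop (hz.comp hφ.tendsto_atTop) _ h1
  · obtain ⟨r, hr, hrU⟩ := Metric.nhds_basis_closedBall.mem_iff.1 (hU.mem_nhds hzU)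
    have h1 := hinf _ hrU (isCompact_closedBall z r) (R + 1)
    have h2 := hφ.tendsto_atTop.eventually (hw _ (Metric.closedBall_mem_nhds z hr))
    obtain ⟨n, h3, w, hw, h4⟩ := (h1.and h2).exists
    have := h3 w hw
    simp only [id] at this
    linarith

namespace LogPieceSystem

variable {f G : ℂ → ℂ} {ℓ : ℝ} {B ι : Type*}

/-- g is a composition of n + 1 maps of the system. The innermost one has image of diameter at most
1, and each of the n others halves distances. -/
theorem exists_branch (S : LogPieceSystem ℓ G B ι) (h : LogInverse f ℓ G) (n : ℕ) :
    ∀ (b : B) (x : ℂ), x ∈ S.level (n + 1) b → ∃ (b' : B) (g : ℂ → ℂ), ∃ y ∈ S.piece b',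
      2 ^ n * (S.center b).re ≤ (S.center b').re ∧ g y = x ∧
      (∀ u ∈ S.piece b', g u ∈ S.piece b ∧ f^[n + 1] (Complex.exp (g u)) = Complex.exp u) ∧
      ∀ u ∈ S.piece b', ‖g u - g y‖ ≤ (1 / 2) ^ n := by
  have hmap : ∀ (b : B) (i : ι), i ∈ S.index b → ∀ u ∈ S.piece (S.child b i),
      f (Complex.exp (S.map b i u)) = Complex.exp u := fun b i hi u hu => by
    rw [S.map_eq, Complex.exp_periodic.int_mul, h.map_exp u (S.lt_re b i hi u hu)]
  have hdiff : ∀ (b : B) (i : ι) (u v : ℂ), S.map b i u - S.map b i v = G u - G v :=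
    fun b i u v => by rw [S.map_eq, S.map_eq]; ring
  induction n with
  | zero =>
    intro b x hx
    rw [S.level_succ] at hx
    obtain ⟨i, hi, y, hy, rfl⟩ := Set.mem_iUnion₂.1 hx
    refine ⟨S.child b i, S.map b i, y, hy, ?_, rfl,
      fun u hu => ⟨S.mapsTo b i hi hu, hmap b i hi u hu⟩, fun u hu => ?_⟩
    · linarith [S.two_mul_re_le b i hi, S.le_re b]
    · rw [hdiff, pow_zero]
      exact S.norm_sub_le_one b i hi u hu y hy
  | succ n ih =>
    intro b x hx
    rw [S.level_succ] at hx
    obtain ⟨i, hi, x', hx', rfl⟩ := Set.mem_iUnion₂.1 hx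
    obtain ⟨b', g, y, hy, hre, rfl, hg, hd⟩ := ih _ x' hx'
    refine ⟨b', S.map b i ∘ g, y, hy, ?_, rfl,
      fun u hu => ⟨S.mapsTo b i hi (hg u hu).1, ?_⟩, fun u hu => ?_⟩
    · refine le_trans ?_ hre
      rw [pow_succ, mul_assoc]
      gcongr
      exact S.two_mul_re_le b i hi
    · rw [Function.iterate_succ_apply, Function.comp_apply, hmap b i hi _ (hg u hu).1,
        (hg u hu).2]
    · rw [Function.comp_apply, Function.comp_apply, hdiff]
      refine (S.norm_sub_le_half b i hi _ (hg u hu).1 _ (hg y hy).1).trans ?_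
      rw [pow_succ]
      linarith [hd u hu]

/-- Level n + 1 is mapped to discs with real parts of order 2^n, so exp x escapes. Each such disc
has radius at least 16 > 2π and so contains a point u with |f(exp u)| ≤ `exp ℓ`. Its pull-back lies
within 2^(-n) of x and its image is small after n + 2 iterations. -/
theorem exp_mem_juliaSet (S : LogPieceSystem ℓ G B ι) (h : LogInverse f ℓ G)
    (hf : ¬ ∃ p : Polynomial ℂ, ∀ z, f z = p.eval z) {b : B} {x : ℂ} (hx : x ∈ S.limitSet b) :
    Complex.exp x ∈ juliaSet f := by
  obtain ⟨x₀, hx₀⟩ := h.exists_norm_le_on_segment hf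
  have hbr := fun n => S.exists_branch h n b x (Set.mem_iInter.1 hx (n + 1))
  have hpow : ∀ n : ℕ, ∀ b' : B, 2 ^ n * (S.center b).re ≤ (S.center b').re →
      2 ^ n * 64 ≤ (S.center b').re := fun n b' hb' => le_trans (by gcongr; exact S.le_re b) hb'
  have h2 : Tendsto (fun n : ℕ => (2 : ℝ) ^ n) atTop atTop :=
    tendsto_pow_atTop_atTop_of_one_lt one_lt_two
  refine mem_juliaSet_of_escaping_of_eventually_small (R := Real.exp ℓ) ?_ fun U hU => ?_
  · rw [← tendsto_add_atTop_iff_nat 1]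
    refine tendsto_atTop_mono (fun n => ?_) h2
    obtain ⟨b', g, y, hy, hre, rfl, hg, -⟩ := hbr n
    rw [(hg y hy).2, Complex.norm_exp]
    rw [S.piece_eq, Metric.mem_closedBall, dist_eq_norm] at hy
    have h3 := (abs_le.1 ((Complex.abs_re_le_norm _).trans hy)).1
    rw [Complex.sub_re] at h3
    have h4 := S.radius_le b'
    have h5 := hpow n b' hre
    have h6 : (0 : ℝ) < 2 ^ n := by positivity
    linarith [Real.add_one_le_exp y.re]
  · obtain ⟨r, hr, hrU⟩ := Metric.mem_nhds_iff.1 (Complex.continuous_exp.continuousAt hU)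
    have h3 : ∀ᶠ n : ℕ in atTop, (1 / 2 : ℝ) ^ n < r :=
      (tendsto_pow_atTop_nhds_zero_of_lt_one (by norm_num) (by norm_num)).eventually_lt_const hr
    have h4 := h3.and (h2.eventually_ge_atTop x₀)
    obtain ⟨N, hN⟩ := eventually_atTop.1 h4
    filter_upwards [eventually_ge_atTop (N + 2)] with m hm
    obtain ⟨n, rfl⟩ : ∃ n, m = n + 2 := ⟨m - 2, by omega⟩
    obtain ⟨h5, h6⟩ := hN n (by omega)
    obtain ⟨b', g, y, hy, hre, rfl, hg, hd⟩ := hbr n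
    have h7 := hpow n b' hre
    have h8 : (0 : ℝ) < 2 ^ n := by positivity
    obtain ⟨t, ht, hle⟩ := hx₀ (S.center b') (by linarith)
    have hu : S.center b' + t * Complex.I ∈ S.piece b' := by
      rw [S.piece_eq, Metric.mem_closedBall, dist_eq_norm, add_sub_cancel_left, norm_mul,
        Complex.norm_I, mul_one, Complex.norm_real, Real.norm_of_nonneg ht.1]
      linarith [ht.2, Real.pi_lt_four, S.le_radius b']
    refine ⟨Complex.exp (g (S.center b' + t * Complex.I)), hrU ?_, ?_⟩
    · rw [Metric.mem_ball, dist_eq_norm]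
      exact (hd _ hu).trans_lt h5
    · rw [Function.iterate_succ_apply', (hg _ hu).2]
      exact hle

end LogPieceSystem

/-! ### Transfer of dimension by `exp`, and conclusion -/

theorem dimH_le_dimH_image_exp_of_subset_closedBall {A : Set ℂ} {a : ℂ}
    (hA : A ⊆ Metric.closedBall a 1) : dimH A ≤ dimH (Complex.exp '' A) := by
  have hmem : ∀ x ∈ A, Complex.exp x / Complex.exp a ∈ Complex.slitPlane ∧
      a + Complex.log (Complex.exp x / Complex.exp a) = x := fun x hx => by
    have h1 := hA hx
    rw [Metric.mem_closedBall, dist_eq_norm] at h1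
    have h2 := abs_le.1 ((Complex.abs_im_le_norm _).trans h1)
    have h3 := Real.pi_gt_three
    rw [← Complex.exp_sub, Complex.log_exp (by linarith) (by linarith)]
    refine ⟨Complex.mem_slitPlane_iff.2 (Or.inl ?_), by ring⟩
    rw [Complex.exp_re]
    exact mul_pos (Real.exp_pos _) (Real.cos_pos_of_mem_Ioo ⟨by linarith, by linarith⟩)
  -- On a ball of radius 1 < π/2 the exponential is inverted by a branch of the logarithm, which is
  -- locally Lipschitz and so does not raise dimension.
  have himage : (fun w => a + Complex.log (w / Complex.exp a)) '' (Complex.exp '' A) = A := by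
    rw [Set.image_image]
    exact (Set.image_congr fun x hx => (hmem x hx).2).trans (Set.image_id A)
  conv_lhs => rw [← himage]
  refine dimH_image_le_of_locally_lipschitzOn ?_
  rintro _ ⟨x, hx, rfl⟩
  have hc : ContDiffAt ℂ 1 (fun w => a + Complex.log (w / Complex.exp a)) (Complex.exp x) :=
    contDiffAt_const.add (ContDiffAt.comp (g := Complex.log)
      (f := fun w => w / Complex.exp a) (Complex.exp x) (Complex.contDiffAt_log (hmem x hx).1)
      (contDiffAt_id.div_const _))
  obtain ⟨K, t, ht, hK⟩ := hc.exists_lipschitzOnWith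
  exact ⟨K, t, mem_nhdsWithin_of_mem_nhds ht, hK⟩

theorem dimH_le_dimH_image_exp (A : Set ℂ) : dimH A ≤ dimH (Complex.exp '' A) := by
  refine le_of_forall_lt fun r hr => ?_
  obtain ⟨x, -, hx⟩ := exists_mem_nhdsWithin_lt_dimH_of_lt_dimH hr
  have h1 := hx (Metric.closedBall x 1 ∩ A)
    (inter_mem (mem_nhdsWithin_of_mem_nhds (Metric.closedBall_mem_nhds x one_pos))
      self_mem_nhdsWithin)
  exact h1.trans_le ((dimH_le_dimH_image_exp_of_subset_closedBall Set.inter_subset_left).trans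
    (dimH_mono (Set.image_mono Set.inter_subset_right)))

theorem ClassB.le_dimH_juliaSet {f : ℂ → ℂ} (hf : ClassB f) {q : ℝ} (hq : 1 ≤ q)
    (hgrow : ∀ ε : ℝ, 0 < ε → ∃ r : ℝ, 0 < r ∧ ∀ z : ℂ, r ≤ ‖z‖ →
      ‖f z‖ ≤ Real.exp (Real.exp ((Real.log ‖z‖) ^ (q + ε)))) :
    ENNReal.ofReal (1 + 1 / q) ≤ dimH (juliaSet f) := by
  have hq0 : 0 < q := by linarith
  obtain ⟨ℓ, G, h⟩ := hf.exists_logInverse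
  have key : ∀ s : ℝ, 1 < s → s < 1 + 1 / q → ENNReal.ofReal s ≤ dimH (juliaSet f) := by
    intro s hs hsq
    have hd0 : 0 < 1 + q - q * s := by
      have : q * s < q * (1 + 1 / q) := by gcongr
      rw [mul_add, mul_one_div_cancel hq0.ne'] at this
      linarith
    -- The growth hypothesis is used with ε = d/8.
    obtain ⟨T₁, C, hb⟩ := h.exists_bounded hf.1.2 (hgrow ((1 + q - q * s) / 8) (by positivity))
    obtain ⟨B, S, b, hdim⟩ := hb.exists_logPieceSystem hq hs rfl hd0
    refine hdim.trans ((dimH_le_dimH_image_exp _).trans (dimH_mono ?_))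
    rintro _ ⟨x, hx, rfl⟩
    exact S.exp_mem_juliaSet h hf.1.2 hx
  have h1 : (1 : ℝ) < 1 + 1 / q := by
    have : 0 < 1 / q := by positivity
    linarith
  refine le_of_tendsto (x := 𝓝[<] (1 + 1 / q))
    (ENNReal.continuous_ofReal.continuousAt.tendsto.mono_left nhdsWithin_le_nhds) ?_
  filter_upwards [Ioo_mem_nhdsLT h1] with s hs
  exact key s hs.1 hs.2

theorem norm_le_maxModulus {f : ℂ → ℂ} (hf : Continuous f) (z : ℂ) :
    ‖f z‖ ≤ maxModulus ‖z‖ f :=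
  le_csSup ((isCompact_sphere 0 ‖z‖).image hf.norm).bddAbove ⟨z, by simp, rfl⟩

/-- By contraposition: if M exceeds the double exponential, all three logarithms have positive
arguments, so default values of `Real.log` play no role. -/
theorem le_exp_exp_of_log_log_log_le {M x p : ℝ} (hx : 0 < x) (hx' : 0 < Real.log x)
    (h : Real.log (Real.log (Real.log M)) / Real.log x ≤ p) : M ≤ Real.exp (Real.exp (x ^ p)) := by
  rw [div_le_iff₀ hx'] at h
  have hxp : x ^ p = Real.exp (p * Real.log x) := by
    rw [Real.rpow_def_of_pos hx, mul_comm]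
  by_contra! hM
  have h1 : Real.exp (x ^ p) < Real.log M :=
    (Real.lt_log_iff_exp_lt ((Real.exp_pos _).trans hM)).2 hM
  have h2 : x ^ p < Real.log (Real.log M) :=
    (Real.lt_log_iff_exp_lt ((Real.exp_pos _).trans h1)).2 h1
  rw [hxp] at h2
  have h3 := (Real.lt_log_iff_exp_lt ((Real.exp_pos _).trans h2)).2 h2
  linarith

theorem growth_of_limsup_eq_one {f : ℂ → ℂ} (hf : Continuous f)
    (hlim : limsup (fun r : ℝ => ((Real.log (Real.log (Real.log (maxModulus r f))) /
      Real.log (Real.log r) : ℝ) : EReal)) atTop = 1) {ε : ℝ} (hε : 0 < ε) :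
    ∃ r : ℝ, 0 < r ∧ ∀ z : ℂ, r ≤ ‖z‖ →
      ‖f z‖ ≤ Real.exp (Real.exp ((Real.log ‖z‖) ^ (1 + ε))) := by
  have h1 : limsup (fun r : ℝ => ((Real.log (Real.log (Real.log (maxModulus r f))) /
      Real.log (Real.log r) : ℝ) : EReal)) atTop < ((1 + ε : ℝ) : EReal) := by
    rw [hlim]
    exact_mod_cast (show (1 : ℝ) < 1 + ε by linarith)
  have h2 := eventually_lt_of_limsup_lt h1
  -- log r > 1 makes the denominator log log r positive.
  have h3 := (Real.tendsto_log_atTop.eventually_gt_atTop 1)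
  obtain ⟨r, hr⟩ := eventually_atTop.1 (h2.and h3)
  refine ⟨max r 1, by positivity, fun z hz => (norm_le_maxModulus hf z).trans ?_⟩
  obtain ⟨h4, h5⟩ := hr ‖z‖ ((le_max_left _ _).trans hz)
  exact le_exp_exp_of_log_log_log_le (by linarith) (Real.log_pos h5)
    (EReal.coe_lt_coe_iff.1 h4).le

end EntireDynamics

theorem theorem1 (f : ℂ → ℂ) (hf : EntireDynamics.ClassB f) :
    (∀ q : ℝ, 1 ≤ q →
      (∀ ε : ℝ, 0 < ε → ∃ r : ℝ, 0 < r ∧ ∀ z : ℂ, r ≤ ‖z‖ →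
        ‖f z‖ ≤ Real.exp (Real.exp ((Real.log ‖z‖) ^ (q + ε)))) →
      ENNReal.ofReal (1 + 1 / q) ≤ dimH (EntireDynamics.juliaSet f)) ∧
    (limsup (fun r : ℝ =>
        ((Real.log (Real.log (Real.log (EntireDynamics.maxModulus r f))) /
          Real.log (Real.log r) : ℝ) : EReal)) atTop = 1 →
      dimH (EntireDynamics.juliaSet f) = 2) := by
  have hi := fun q hq => hf.le_dimH_juliaSet (q := q) hq
  refine ⟨hi, fun hlim => le_antisymm ?_ ?_⟩
  · refine (dimH_mono (Set.subset_univ _)).trans ?_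
    rw [Real.dimH_univ_eq_finrank, Complex.finrank_real_complex]
    rfl
  · have := hi 1 le_rfl fun ε hε => EntireDynamics.growth_of_limsup_eq_one hf.1.1.continuous hlim hε
    norm_num at this
    exact this
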